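/- Let $H$ be a complex Hilbert space and let $A\subseteq B(H)$ be an operator algebra, i.e. a norm closed subalgebra containing a contractive approximate identity. An operator space is a Banach space $E$ with norms on all $M_n(E)$, extending that of $E=M_1(E)$ and satisfying Ruan's axioms. Let $\mathrm{OMOD}_A$ be the category whose objects are the non-degenerate right operator $A$-modules, i.e. the operator spaces $E$ with a right $A$-module structure such that the induced map $E\otimes_h A\to E$ on the Haagerup tensor product is completely contractive and the linear span of $\{x\cdot a : x\in E,\ a\in A\}$ is dense in $E$, and whose morphisms are the completely bounded $A$-module maps. A kernel–cokernel pair is a pair of composable morphisms $(\mu,\pi)$ such that $\mu$ is a kernel of $\pi$ and $\pi$ is a cokernel of $\mu$. An exact structure on an additive category is an isomorphism-closed class of kernel–cokernel pairs, whose first (second) components are called admissible monomorphisms (epimorphisms), such that: identities are admissible monomorphisms and admissible epimorphisms; admissible monomorphisms and admissible epimorphisms are each closed under composition; pushouts of admissible monomorphisms along arbitrary morphisms exist and are admissible monomorphisms; pullbacks of admissible epimorphisms along arbitrary morphisms exist and are admissible epimorphisms. Then: 1. $\mathrm{OMOD}_A$ is additive, and the class of all kernel–cokernel pairs is an exact structure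 on $\mathrm{OMOD}_A$. 2. $\mathrm{OMOD}_A$ is quasi-abelian: it is additive, every morphism has a kernel and a cokernel, and the class of all kernel–cokernel pairs satisfies the above pushout and pullback conditions. 3. A morphism $f:E\to F$ is a kernel of some morphism if and only if $f(E)$ is closed in $F$ and $f$, viewed as a map onto $f(E)$, is a bijective completely bounded $A$-module map with completely bounded inverse. 4. A morphism $f:E\to F$ is a cokernel of some morphism if and only if it is completely open, i.e. there is $\gamma>0$ such that for every $n$ each $y\in M_n(F)$ with $\|y\|_n<\gamma$ equals $f_n(x)$ for some $x\in M_n(E)$ with $\|x\|_n<1$, where $f_n$ denotes entrywise application of $f$. 5. All pullbacks exist in $\mathrm{OMOD}_A$, and in every pullback square with $f:E\to G$, $g:F\to G$ and projections $p:L\to E$, $q:L\to F$, if $f$ is a cokernel of some morphism, then so is $q$. 6. All pushouts exist in $\mathrm{OMOD}_A$, and in every pushout square with $f:G\to E$, $g:G\to F$ and $p:E\to L$, $q:F\to L$, if $f$ is a kernel of some morphism, then so is $q$. -/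

import Mathlib

open CategoryTheory CategoryTheory.Limits
open scoped TensorProduct ENNReal

universe u v w

/-! ## Exact and quasi-abelian categories -/

namespace ExactCat

variable {C : Type u} [Category.{v} C] [Preadditive C]

/-- A preadditive category is additive if it has a zero object and a product of any two
objects. -/
structure IsAdditive (C : Type u) [Category.{v} C] [Preadditive C] : Prop where
  hasZeroObject : HasZeroObject C
  hasBinaryProducts : HasBinaryProducts C

/-- `f` is a kernel of some morphism. -/
def IsKernelMap {X Y : C} (f : X ⟶ Y) : Prop :=
  ∃ (Z : C) (g : Y ⟶ Z) (w : f ≫ g = 0), Nonempty (IsLimit (KernelFork.ofι f w))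

/-- `g` is a cokernel of some morphism. -/
def IsCokernelMap {Y Z : C} (g : Y ⟶ Z) : Prop :=
  ∃ (X : C) (f : X ⟶ Y) (w : f ≫ g = 0), Nonempty (IsColimit (CokernelCofork.ofπ g w))

/-- A kernel-cokernel pair `X ⟶ Y ⟶ Z`: the first morphism is a kernel of the second one, and the
second one is a cokernel of the first one. This is also the class of all kernel-cokernel pairs,
as a class of composable pairs of morphisms with zero composite. -/
def KernelCokernelPair (S : ShortComplex C) : Prop :=
  Nonempty (IsLimit (KernelFork.ofι S.f S.zero)) ∧
    Nonempty (IsColimit (CokernelCofork.ofπ S.g S.zero))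

/-- `f` is the first morphism of a pair in the class `𝓔`. -/
def AdmissibleMono (𝓔 : ShortComplex C → Prop) {X Y : C} (f : X ⟶ Y) : Prop :=
  ∃ (Z : C) (g : Y ⟶ Z) (w : f ≫ g = 0), 𝓔 (ShortComplex.mk f g w)

/-- `g` is the second morphism of a pair in the class `𝓔`. -/
def AdmissibleEpi (𝓔 : ShortComplex C → Prop) {Y Z : C} (g : Y ⟶ Z) : Prop :=
  ∃ (X : C) (f : X ⟶ Y) (w : f ≫ g = 0), 𝓔 (ShortComplex.mk f g w)

/-- The pushout of an admissible monomorphism along an arbitrary morphism exists and yields an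
admissible monomorphism. -/
def AxiomE2 (𝓔 : ShortComplex C → Prop) : Prop :=
  ∀ {X Y Z : C} (f : X ⟶ Y) (g : X ⟶ Z), AdmissibleMono 𝓔 f →
    HasPushout f g ∧
      ∀ {P : C} (h : Y ⟶ P) (k : Z ⟶ P), IsPushout f g h k → AdmissibleMono 𝓔 k

/-- The pullback of an admissible epimorphism along an arbitrary morphism exists and yields an
admissible epimorphism. -/
def AxiomE2op (𝓔 : ShortComplex C → Prop) : Prop :=
  ∀ {X Y Z : C} (f : X ⟶ Z) (g : Y ⟶ Z), AdmissibleEpi 𝓔 f →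
    HasPullback f g ∧
      ∀ {P : C} (h : P ⟶ X) (k : P ⟶ Y), IsPullback h k f g → AdmissibleEpi 𝓔 k

/-- A (Quillen) exact structure: an isomorphism-closed class of kernel-cokernel pairs
satisfying the axioms E0, E1, E2 and their duals. -/
structure IsExactStructure (𝓔 : ShortComplex C → Prop) : Prop where
  kernelCokernelPair : ∀ S : ShortComplex C, 𝓔 S → KernelCokernelPair S
  of_iso : ∀ S T : ShortComplex C, Nonempty (S ≅ T) → 𝓔 S → 𝓔 T
  e0 : ∀ X : C, AdmissibleMono 𝓔 (𝟙 X)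
  e0op : ∀ X : C, AdmissibleEpi 𝓔 (𝟙 X)
  e1 : ∀ {X Y Z : C} (f : X ⟶ Y) (g : Y ⟶ Z),
    AdmissibleMono 𝓔 f → AdmissibleMono 𝓔 g → AdmissibleMono 𝓔 (f ≫ g)
  e1op : ∀ {X Y Z : C} (f : X ⟶ Y) (g : Y ⟶ Z),
    AdmissibleEpi 𝓔 f → AdmissibleEpi 𝓔 g → AdmissibleEpi 𝓔 (f ≫ g)
  e2 : AxiomE2 𝓔
  e2op : AxiomE2op 𝓔

/-- A quasi-abelian category: an additive category with all kernels and cokernels in which the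
class of all kernel-cokernel pairs satisfies E2 and its dual. -/
structure IsQuasiAbelian (C : Type u) [Category.{v} C] [Preadditive C] : Prop where
  isAdditive : IsAdditive C
  hasKernels : HasKernels C
  hasCokernels : HasCokernels C
  e2 : AxiomE2 (KernelCokernelPair (C := C))
  e2op : AxiomE2op (KernelCokernelPair (C := C))

end ExactCat

/-! ## Operator spaces, operator algebras and the Haagerup tensor norm -/

namespace OpMod

/-- The product `α x β` of a matrix `x` with entries in `E` and scalar matrices `α`, `β`. -/
def scalarMul {E : Type u} [AddCommGroup E] [Module ℂ E] {m n : ℕ}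
    (α : Matrix (Fin n) (Fin m) ℂ) (x : Matrix (Fin m) (Fin m) E)
    (β : Matrix (Fin m) (Fin n) ℂ) : Matrix (Fin n) (Fin n) E :=
  fun i j => ∑ k, ∑ l, (α i k * β l j) • x k l

/-- The block matrix with rows `[x, y]` and `[z, t]`, indexed by `Fin (m + n)`. -/
def blocks {E : Type u} {m n : ℕ} (x : Matrix (Fin m) (Fin m) E) (y : Matrix (Fin m) (Fin n) E)
    (z : Matrix (Fin n) (Fin m) E) (t : Matrix (Fin n) (Fin n) E) :
    Matrix (Fin (m + n)) (Fin (m + n)) E :=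
  Matrix.reindex finSumFinEquiv finSumFinEquiv (Matrix.fromBlocks x y z t)

open scoped Matrix.Norms.L2Operator in
/-- A (complete) operator space: a Banach space with norms on all spaces `M_n(E)` satisfying
Ruan's axioms, the norm on `M_1(E)` being the given norm of `E`. In `matNorm_scalarMul`, the norms
of the scalar matrices are their operator norms between Euclidean spaces. (It follows that each
`matNorm n` is definite, since it dominates the norms of the entries, and complete.) -/
class OperatorSpace (E : Type u) [NormedAddCommGroup E] [NormedSpace ℂ E] extends
    CompleteSpace E where
  matNorm : ∀ n : ℕ, Seminorm ℂ (Matrix (Fin n) (Fin n) E)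
  matNorm_one : ∀ x : Matrix (Fin 1) (Fin 1) E, matNorm 1 x = ‖x 0 0‖
  matNorm_blocks : ∀ {m n : ℕ} (x : Matrix (Fin m) (Fin m) E) (y : Matrix (Fin n) (Fin n) E),
    matNorm (m + n) (blocks x 0 0 y) = max (matNorm m x) (matNorm n y)
  matNorm_scalarMul : ∀ {m n : ℕ} (α : Matrix (Fin n) (Fin m) ℂ) (x : Matrix (Fin m) (Fin m) E)
    (β : Matrix (Fin m) (Fin n) ℂ), matNorm n (scalarMul α x β) ≤ ‖α‖ * matNorm m x * ‖β‖

/-- The norm of a rectangular matrix over an operator space, as the norm of the square matrix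
obtained by adding zero blocks. -/
noncomputable def rectNorm {E : Type u} [NormedAddCommGroup E] [NormedSpace ℂ E] [OperatorSpace E] {n p : ℕ}
    (x : Matrix (Fin n) (Fin p) E) : ℝ :=
  OperatorSpace.matNorm (n + p) (blocks 0 x 0 0)

section OperatorAlgebra

variable {H : Type v} [NormedAddCommGroup H] [InnerProductSpace ℂ H]

/-- The operator `H ^ n → H ^ m` between Hilbert space direct sums given by a matrix of bounded
operators on `H`. -/
noncomputable def matrixOp {m n : ℕ} (a : Matrix (Fin m) (Fin n) (H →L[ℂ] H)) :
    PiLp 2 (fun _ : Fin n => H) →L[ℂ] PiLp 2 (fun _ : Fin m => H) :=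
  ((PiLp.continuousLinearEquiv 2 ℂ (fun _ : Fin m => H)).symm : _ →L[ℂ] _) ∘L
    ContinuousLinearMap.pi fun i => ∑ j, a i j ∘L PiLp.proj 2 (fun _ : Fin n => H) j

/-- The norm of an `m × n` matrix over a subalgebra of `B(H)`, as an operator `H ^ n → H ^ m`. -/
noncomputable def opNorm {A : NonUnitalSubalgebra ℂ (H →L[ℂ] H)} {m n : ℕ}
    (a : Matrix (Fin m) (Fin n) A) : ℝ :=
  ‖matrixOp (a.map fun b => (b : H →L[ℂ] H))‖

/-- `A` is an operator algebra: a norm closed subalgebra of `B(H)` containing a contractive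
approximate identity (a net, here a filter, in the unit ball of `A`). -/
structure IsOperatorAlgebra (A : NonUnitalSubalgebra ℂ (H →L[ℂ] H)) : Prop where
  isClosed : IsClosed (A : Set (H →L[ℂ] H))
  exists_approximateUnit :
    ∃ l : Filter A, l.IsApproximateUnit ∧ ∀ᶠ e : A in l, ‖(e : H →L[ℂ] H)‖ ≤ 1

variable {E : Type u} [NormedAddCommGroup E] [NormedSpace ℂ E] [OperatorSpace E]
variable {A : NonUnitalSubalgebra ℂ (H →L[ℂ] H)}

/-- The matrix `x ⊙ a` over `E ⊗ A` with entries `∑ k, x i k ⊗ a k j`. -/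
def odot {n p : ℕ} (x : Matrix (Fin n) (Fin p) E) (a : Matrix (Fin p) (Fin n) A) :
    Matrix (Fin n) (Fin n) (E ⊗[ℂ] A) :=
  fun i j => ∑ k, x i k ⊗ₜ[ℂ] a k j

/-- Every matrix over `E ⊗ A` has a factorization as in the definition of the Haagerup norm. -/
theorem exists_eq_odot {n : ℕ} (t : Matrix (Fin n) (Fin n) (E ⊗[ℂ] A)) :
    ∃ (p : ℕ) (x : Matrix (Fin n) (Fin p) E) (a : Matrix (Fin p) (Fin n) A),
      t = odot x a := by
  classical
  have h := fun i j => TensorProduct.exists_finset (t i j)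
  choose S hS using h
  let ι := Σ ij : Fin n × Fin n, S ij.1 ij.2
  let e := Fintype.equivFin ι
  refine ⟨Fintype.card ι, fun i k => if (e.symm k).1.1 = i then (e.symm k).2.1.1 else 0,
    fun k j => if (e.symm k).1.2 = j then (e.symm k).2.1.2 else 0, ?_⟩
  ext i j
  rw [hS i j]
  refine Eq.trans ?_ (e.symm.sum_comp fun s : ι =>
    (if s.1.1 = i then s.2.1.1 else 0) ⊗ₜ[ℂ] (if s.1.2 = j then s.2.1.2 else 0)).symm
  rw [Fintype.sum_sigma, Finset.sum_eq_single (i, j)]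
  · simp only [if_true]
    exact (Finset.sum_coe_sort (S i j) (fun s => s.1 ⊗ₜ[ℂ] s.2)).symm
  · rintro ⟨i', j'⟩ - hne
    apply Finset.sum_eq_zero
    intro s _
    dsimp only
    split_ifs with h1 h2
    · exact absurd (Prod.ext h1 h2) hne
    all_goals simp
  · simp

/-- The Haagerup tensor norm on `M_n(E ⊗ A)`: the infimum of `‖x‖ ‖a‖` over all factorizations
`t = x ⊙ a` with `x ∈ M_{n,p}(E)`, `a ∈ M_{p,n}(A)`. -/
noncomputable def haagerupNorm {n : ℕ} (t : Matrix (Fin n) (Fin n) (E ⊗[ℂ] A)) : ℝ :=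
  sInf {r | ∃ (p : ℕ) (x : Matrix (Fin n) (Fin p) E) (a : Matrix (Fin p) (Fin n) A),
    t = odot x a ∧ r = rectNorm x * opNorm a}

end OperatorAlgebra

end OpMod

/-! ## The category of operator modules -/

open OpMod

/-- A non-degenerate right operator `A`-module: a complete operator space `E` with a (bilinear,
associative) right action of `A` such that the induced map from the Haagerup tensor product of `E`
and `A` to `E` is completely contractive and the span of the elements `x · a` is dense in `E`.
(A completely contractive map on the algebraic tensor product with the Haagerup norms is the
same as one on its completion.) -/
structure OMod {H : Type v} [NormedAddCommGroup H] [InnerProductSpace ℂ H]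
    (A : NonUnitalSubalgebra ℂ (H →L[ℂ] H)) where
  carrier : Type u
  [normedAddCommGroup : NormedAddCommGroup carrier]
  [normedSpace : NormedSpace ℂ carrier]
  [operatorSpace : OperatorSpace carrier]
  act : carrier →ₗ[ℂ] A →ₗ[ℂ] carrier
  act_mul : ∀ (x : carrier) (a b : A), act x (a * b) = act (act x a) b
  act_completelyContractive : ∀ (n : ℕ) (t : Matrix (Fin n) (Fin n) (carrier ⊗[ℂ] A)),
    OperatorSpace.matNorm n (t.map (TensorProduct.lift act)) ≤ haagerupNorm t
  nondegenerate : Dense (Submodule.span ℂ {z : carrier | ∃ x a, z = act x a} : Set carrier)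

namespace OMod

variable {H : Type v} [NormedAddCommGroup H] [InnerProductSpace ℂ H]
variable {A : NonUnitalSubalgebra ℂ (H →L[ℂ] H)}

instance : CoeSort (OMod.{u} A) (Type u) := ⟨OMod.carrier⟩

instance (E : OMod.{u} A) : NormedAddCommGroup E := E.normedAddCommGroup
instance (E : OMod.{u} A) : NormedSpace ℂ E := E.normedSpace
instance (E : OMod.{u} A) : OperatorSpace E := E.operatorSpace

/-- The norm of `M_n(E)`. -/
noncomputable def mnorm {E : OMod.{u} A} {n : ℕ} (x : Matrix (Fin n) (Fin n) E) : ℝ :=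
  OperatorSpace.matNorm n x

/-- The group `CB_A(E, F)` of completely bounded `A`-module maps from `E` to `F`. -/
def CB (E F : OMod.{u} A) : AddSubgroup (E →ₗ[ℂ] F) where
  carrier := {f | (∀ x a, f (E.act x a) = F.act (f x) a) ∧
    ∃ c : ℝ, ∀ (n : ℕ) (x : Matrix (Fin n) (Fin n) E), mnorm (x.map f) ≤ c * mnorm x}
  zero_mem' := by
    refine ⟨fun x a => by simp, 0, fun n x => ?_⟩
    have h : x.map (0 : E →ₗ[ℂ] F) = 0 := by ext; simp
    simp [h, mnorm]
  add_mem' := by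
    rintro f g ⟨hf, c, hc⟩ ⟨hg, d, hd⟩
    refine ⟨fun x a => by simp [hf, hg], c + d, fun n x => ?_⟩
    have h : x.map (f + g : E →ₗ[ℂ] F) = x.map f + x.map g := by ext; simp
    rw [h, add_mul]
    exact (map_add_le_add _ _ _).trans (add_le_add (hc n x) (hd n x))
  neg_mem' := by
    rintro f ⟨hf, c, hc⟩
    refine ⟨fun x a => by simp [hf], c, fun n x => ?_⟩
    have h : x.map (-f : E →ₗ[ℂ] F) = -x.map f := by ext; simp
    rw [h]
    exact (map_neg_eq_map (OperatorSpace.matNorm n) (x.map f)).trans_le (hc n x)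

/-- Objects: non-degenerate right operator `A`-modules. Morphisms: completely bounded `A`-module
maps. -/
instance : Category (OMod.{u} A) where
  Hom E F := CB E F
  id E := ⟨LinearMap.id, fun _ _ => rfl, 1, fun n x => by simp⟩
  comp f g := ⟨g.1 ∘ₗ f.1, fun x a => by simp [f.2.1, g.2.1], by
    obtain ⟨c, hc⟩ := f.2.2
    obtain ⟨d, hd⟩ := g.2.2
    refine ⟨max d 0 * c, fun n x => ?_⟩
    have h : x.map (g.1 ∘ₗ f.1) = (x.map f.1).map g.1 := by ext; simp
    rw [h, mul_assoc]
    refine (hd n _).trans ?_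
    refine (mul_le_mul_of_nonneg_right (le_max_left d 0) (apply_nonneg _ _)).trans ?_
    exact mul_le_mul_of_nonneg_left (hc n x) (le_max_right d 0)⟩

/-- The linear map underlying a morphism. -/
def lin {E F : OMod.{u} A} (f : E ⟶ F) : E →ₗ[ℂ] F := f.1

instance : Preadditive (OMod.{u} A) where
  homGroup E F := inferInstanceAs (AddCommGroup (CB E F))
  add_comp _ _ _ f f' g := Subtype.ext (LinearMap.comp_add f.1 f'.1 g.1)
  comp_add _ _ _ f g g' := Subtype.ext (LinearMap.add_comp f.1 g'.1 g.1)

/-- `f` has closed range and is, as a map onto its range (with the matrix norms and the module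
action of `F`), a bijective completely bounded `A`-module map with completely bounded inverse
`g`. -/
def IsCBIsoOntoClosedRange {E F : OMod.{u} A} (f : E ⟶ F) : Prop :=
  IsClosed (LinearMap.range (lin f) : Set F) ∧
    ∃ g : LinearMap.range (lin f) →ₗ[ℂ] E,
      (∀ x, g ((lin f).rangeRestrict x) = x) ∧
      (∀ y, (lin f).rangeRestrict (g y) = y) ∧
      (∀ (y z : LinearMap.range (lin f)) (a : A),
        (z : F) = F.act y a → g z = E.act (g y) a) ∧
      ∃ c : ℝ, ∀ (n : ℕ) (y : Matrix (Fin n) (Fin n) (LinearMap.range (lin f))),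
        mnorm (y.map g) ≤ c * mnorm (y.map fun z => (z : F))

/-- `f` is completely open: for some `γ > 0` and all `n`, the amplification of `f` maps the open
unit ball of `M_n(E)` onto a set containing the open `γ`-ball of `M_n(F)`. -/
def IsCompletelyOpen {E F : OMod.{u} A} (f : E ⟶ F) : Prop :=
  ∃ γ : ℝ, 0 < γ ∧ ∀ (n : ℕ) (y : Matrix (Fin n) (Fin n) F), mnorm y < γ →
    ∃ x : Matrix (Fin n) (Fin n) E, mnorm x < 1 ∧ x.map (lin f) = y

end OMod

/-! Kernels and cokernels are recognised by two estimates that are uniform in the matrix size. A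
morphism is a kernel exactly when it is completely bounded below, and a cokernel exactly when it is
completely open. Both classes contain the isomorphisms, are closed under composition, and cancel on
one side: the first factor of a composite that is completely bounded below is again so, and the last
factor of a completely open composite is completely open. The axioms thereby become estimates.

The characterisation rests on concrete models: the null space with inherited matrix norms, and the
quotient by the closure of the range with quotient matrix norms. Both must be shown to be operator
modules. The delicate point is that a closed submodule is non-degenerate, which holds because `x ·
e` tends to `x` along a contractive approximate identity (`tendsto_act`). An arbitrary kernel or
cokernel factors through its model, so cancellation gives the estimate; conversely `exists_lift` and
`exists_desc` turn the estimates into universal properties.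

For pullbacks and pushouts a single comparison morphism with the model suffices, again by
cancellation. The pullback model is the kernel of `f - g` on `E × F`: an element `y` of `F` is
lifted by solving `f x = g y` with control of the norm. The pushout model is the quotient of `E × F`
by the range of `(f, -g)`; this range is closed when `f` is completely bounded below, so elements
that vanish in the quotient come from `G` and can be estimated through `f`. -/

namespace OpMod

/-! ### Matrices over operator spaces -/

section Matrices

section Algebra

variable {E : Type u} [AddCommGroup E] [Module ℂ E] {F : Type v} [AddCommGroup F] [Module ℂ F]

theorem blocks_map {m n : ℕ} (f : E →ₗ[ℂ] F) (x : Matrix (Fin m) (Fin m) E)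
    (y : Matrix (Fin m) (Fin n) E) (z : Matrix (Fin n) (Fin m) E) (t : Matrix (Fin n) (Fin n) E) :
    (blocks x y z t).map f = blocks (x.map f) (y.map f) (z.map f) (t.map f) := by
  simp only [blocks, Matrix.reindex_apply]
  rw [← Matrix.submatrix_map, Matrix.fromBlocks_map]

theorem zero_map {m n : Type*} (f : E →ₗ[ℂ] F) : (0 : Matrix m n E).map f = 0 := by
  ext; simp

theorem add_map {m n : Type*} (f : E →ₗ[ℂ] F) (x y : Matrix m n E) :
    (x + y).map f = x.map f + y.map f := by
  ext; simp

theorem smul_map {m n : Type*} (f : E →ₗ[ℂ] F) (c : ℂ) (x : Matrix m n E) :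
    (c • x).map f = c • x.map f := by
  ext; simp

theorem scalarMul_map {m n : ℕ} (f : E →ₗ[ℂ] F) (α : Matrix (Fin n) (Fin m) ℂ)
    (x : Matrix (Fin m) (Fin m) E) (β : Matrix (Fin m) (Fin n) ℂ) :
    (scalarMul α x β).map f = scalarMul α (x.map f) β := by
  ext i j
  simp [scalarMul]

/-- Entrywise application of a linear map, as a linear map between spaces of matrices. -/
def mapMatrix (m n : Type*) (f : E →ₗ[ℂ] F) : Matrix m n E →ₗ[ℂ] Matrix m n F where
  toFun x := x.map f
  map_add' := add_map f
  map_smul' := smul_map f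

/-- The one by one matrix with a given entry. -/
def single {E : Type*} (x : E) : Matrix (Fin 1) (Fin 1) E := fun _ _ => x

theorem eq_single {E : Type*} (x : Matrix (Fin 1) (Fin 1) E) : x = single (x 0 0) := by
  ext i j
  rw [Subsingleton.elim i 0, Subsingleton.elim j 0]
  rfl

end Algebra

/-- The matrix whose rows are the unit vectors given by a map of the indices. -/
def selection {m n : ℕ} (e : Fin n → Fin m) : Matrix (Fin n) (Fin m) ℂ :=
  fun i k => if e i = k then 1 else 0

open scoped Matrix.Norms.L2Operator in
-- The rows are distinct unit vectors, so `s s* = 1`, and the C*-identity bounds the norm.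
theorem norm_selection_le {m n : ℕ} {e : Fin n → Fin m} (he : Function.Injective e) :
    ‖selection e‖ ≤ 1 := by
  have h : selection e * (selection e).conjTranspose = 1 := by
    ext i j
    rw [Matrix.mul_apply, Finset.sum_eq_single (e i)]
    · by_cases hij : i = j
      · subst hij; simp [selection]
      · simp [selection, he.ne (Ne.symm hij), hij]
    · intro k _ hk
      simp [selection, Ne.symm hk]
    · simp
  have h1 := Matrix.l2_opNorm_conjTranspose_mul_self (selection e).conjTranspose
  rw [Matrix.conjTranspose_conjTranspose, h, Matrix.l2_opNorm_conjTranspose] at h1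
  -- Only an inequality, because for `n = 0` this norm is `0`.
  have h2 : ‖(1 : Matrix (Fin n) (Fin n) ℂ)‖ ≤ 1 := by
    rw [← Matrix.diagonal_one, Matrix.l2_opNorm_diagonal]
    exact (pi_norm_le_iff_of_nonneg zero_le_one).2 fun i => by simp
  nlinarith [norm_nonneg (selection e)]

open scoped Matrix.Norms.L2Operator in
theorem norm_selection_transpose_le {m n : ℕ} {e : Fin n → Fin m} (he : Function.Injective e) :
    ‖(selection e).transpose‖ ≤ 1 := by
  have h : (selection e).transpose = (selection e).conjTranspose := by
    ext i j
    simp [selection, apply_ite]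
  rw [h, Matrix.l2_opNorm_conjTranspose]
  exact norm_selection_le he

variable {E : Type u} [NormedAddCommGroup E] [NormedSpace ℂ E] [OperatorSpace E]

theorem matNorm_single (x : E) : OperatorSpace.matNorm 1 (single x) = ‖x‖ :=
  OperatorSpace.matNorm_one _

open scoped Matrix.Norms.L2Operator in
theorem matNorm_submatrix_le {m n : ℕ} (x : Matrix (Fin m) (Fin m) E) {e f : Fin n → Fin m}
    (he : Function.Injective e) (hf : Function.Injective f) :
    OperatorSpace.matNorm n (x.submatrix e f) ≤ OperatorSpace.matNorm m x := by
  have h : x.submatrix e f = scalarMul (selection e) x (selection f).transpose := by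
    ext i j
    simp [scalarMul, selection]
  rw [h]
  refine (OperatorSpace.matNorm_scalarMul _ _ _).trans ?_
  have h1 := norm_selection_le he
  have h2 := norm_selection_transpose_le hf
  have h0 := apply_nonneg (OperatorSpace.matNorm (E := E) m) x
  calc _ ≤ 1 * OperatorSpace.matNorm m x * 1 := by gcongr
    _ = _ := by ring

theorem matNorm_left_block_le {m n : ℕ} (z : Matrix (Fin (m + n)) (Fin (m + n)) E) :
    OperatorSpace.matNorm m (z.submatrix (Fin.castAdd n) (Fin.castAdd n)) ≤
      OperatorSpace.matNorm (m + n) z :=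
  matNorm_submatrix_le z (Fin.castAdd_injective m n) (Fin.castAdd_injective m n)

theorem matNorm_right_block_le {m n : ℕ} (z : Matrix (Fin (m + n)) (Fin (m + n)) E) :
    OperatorSpace.matNorm n (z.submatrix (Fin.natAdd m) (Fin.natAdd m)) ≤
      OperatorSpace.matNorm (m + n) z :=
  matNorm_submatrix_le z (Fin.natAdd_injective n m) (Fin.natAdd_injective n m)

open scoped Matrix.Norms.L2Operator in
-- Multiplying on both sides by diagonal projections kills every block but the upper right one, and
-- leaves exactly the zero-padded matrix that defines `rectNorm`.
theorem rectNorm_submatrix_le {m n : ℕ} (z : Matrix (Fin (m + n)) (Fin (m + n)) E) :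
    rectNorm (z.submatrix (Fin.castAdd n) (Fin.natAdd m)) ≤ OperatorSpace.matNorm (m + n) z := by
  let p : Fin (m + n) → ℂ := Fin.append (fun _ => 1) (fun _ => 0)
  let q : Fin (m + n) → ℂ := Fin.append (fun _ => 0) (fun _ => 1)
  have h : blocks 0 (z.submatrix (Fin.castAdd n) (Fin.natAdd m)) 0 0 =
      scalarMul (Matrix.diagonal p) z (Matrix.diagonal q) := by
    ext i j
    have : scalarMul (Matrix.diagonal p) z (Matrix.diagonal q) i j = (p i * q j) • z i j := by
      simp [scalarMul, Matrix.diagonal_apply]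
    rw [this]
    refine Fin.addCases (fun i => ?_) (fun i => ?_) i <;>
    refine Fin.addCases (fun j => ?_) (fun j => ?_) j <;>
    simp [blocks, p, q]
  have hp : ‖Matrix.diagonal p‖ ≤ 1 := by
    rw [Matrix.l2_opNorm_diagonal]
    refine (pi_norm_le_iff_of_nonneg zero_le_one).2 fun i => ?_
    refine Fin.addCases (fun i => ?_) (fun i => ?_) i <;> simp [p]
  have hq : ‖Matrix.diagonal q‖ ≤ 1 := by
    rw [Matrix.l2_opNorm_diagonal]
    refine (pi_norm_le_iff_of_nonneg zero_le_one).2 fun i => ?_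
    refine Fin.addCases (fun i => ?_) (fun i => ?_) i <;> simp [q]
  rw [rectNorm, h]
  refine (OperatorSpace.matNorm_scalarMul _ _ _).trans ?_
  have h0 := apply_nonneg (OperatorSpace.matNorm (E := E) (m + n)) z
  calc _ ≤ 1 * OperatorSpace.matNorm (m + n) z * 1 := by gcongr
    _ = _ := by ring

theorem rectNorm_one_le (x : E) : rectNorm (single x) ≤ ‖x‖ := by
  -- Swapping the two columns of the block diagonal matrix `x ⊕ 0` moves `x` to the corner.
  have h : blocks 0 (single x) 0 0 =
      (blocks (single x) 0 0 (0 : Matrix (Fin 1) (Fin 1) E)).submatrix id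
        (Equiv.swap (0 : Fin (1 + 1)) 1) := by
    ext i j
    fin_cases i <;> fin_cases j <;> rfl
  rw [rectNorm, h]
  refine (matNorm_submatrix_le _ Function.injective_id (Equiv.injective _)).trans ?_
  rw [OperatorSpace.matNorm_blocks, matNorm_single]
  simp

theorem rectNorm_nonneg {m n : ℕ} (x : Matrix (Fin m) (Fin n) E) : 0 ≤ rectNorm x :=
  apply_nonneg _ _

end Matrices

/-! ### Closed subspaces, quotients and products of operator spaces -/

section Subspace

variable {E : Type u} [NormedAddCommGroup E] [NormedSpace ℂ E] [OperatorSpace E]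

/-- A closed subspace of an operator space, with the inherited matrix norms. -/
noncomputable instance submoduleOperatorSpace (N : Submodule ℂ E) [hN : IsClosed (N : Set E)] :
    OperatorSpace N where
  toCompleteSpace := hN.completeSpace_coe
  matNorm n := (OperatorSpace.matNorm n).comp (mapMatrix _ _ N.subtype)
  matNorm_one x := by
    change OperatorSpace.matNorm 1 (x.map N.subtype) = _
    rw [OperatorSpace.matNorm_one]
    rfl
  matNorm_blocks x y := by
    change OperatorSpace.matNorm _ ((blocks x 0 0 y).map N.subtype) = _
    rw [blocks_map, zero_map, zero_map, OperatorSpace.matNorm_blocks]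
    rfl
  matNorm_scalarMul α x β := by
    change OperatorSpace.matNorm _ ((scalarMul α x β).map N.subtype) ≤ _
    rw [scalarMul_map]
    exact OperatorSpace.matNorm_scalarMul _ _ _

theorem matNorm_submodule (N : Submodule ℂ E) [IsClosed (N : Set E)] {n : ℕ}
    (x : Matrix (Fin n) (Fin n) N) :
    OperatorSpace.matNorm n x = OperatorSpace.matNorm n (x.map N.subtype) := rfl

theorem rectNorm_submodule (N : Submodule ℂ E) [IsClosed (N : Set E)] {m n : ℕ}
    (x : Matrix (Fin m) (Fin n) N) : rectNorm x = rectNorm (x.map N.subtype) := by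
  rw [rectNorm, matNorm_submodule, blocks_map, zero_map, zero_map, zero_map]
  rfl

end Subspace

section Quotient

theorem exists_map_mkQ {E : Type u} [AddCommGroup E] [Module ℂ E] (N : Submodule ℂ E)
    {m n : Type*} (x : Matrix m n (E ⧸ N)) : ∃ y : Matrix m n E, y.map N.mkQ = x :=
  ⟨fun i j => (N.mkQ_surjective (x i j)).choose, by
    ext i j; exact (N.mkQ_surjective (x i j)).choose_spec⟩

variable {E : Type u} [NormedAddCommGroup E] [NormedSpace ℂ E] [OperatorSpace E]
variable (N : Submodule ℂ E)

/-- The quotient norm of a matrix over `E ⧸ N`. -/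
noncomputable def quotNorm {n : ℕ} (x : Matrix (Fin n) (Fin n) (E ⧸ N)) : ℝ :=
  sInf {r | ∃ y : Matrix (Fin n) (Fin n) E, y.map N.mkQ = x ∧ r = OperatorSpace.matNorm n y}

theorem quotNorm_map_mkQ_le {n : ℕ} (y : Matrix (Fin n) (Fin n) E) :
    quotNorm N (y.map N.mkQ) ≤ OperatorSpace.matNorm n y :=
  csInf_le ⟨0, by rintro r ⟨z, -, rfl⟩; exact apply_nonneg _ _⟩ ⟨y, rfl, rfl⟩

theorem exists_lt_of_quotNorm_lt {n : ℕ} {x : Matrix (Fin n) (Fin n) (E ⧸ N)} {r : ℝ}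
    (h : quotNorm N x < r) :
    ∃ y : Matrix (Fin n) (Fin n) E, y.map N.mkQ = x ∧ OperatorSpace.matNorm n y < r := by
  obtain ⟨y₀, hy₀⟩ := exists_map_mkQ N x
  obtain ⟨_, ⟨y, hy, rfl⟩, hlt⟩ := exists_lt_of_csInf_lt (s := {r | ∃ y : Matrix (Fin n) (Fin n) E,
    y.map N.mkQ = x ∧ r = OperatorSpace.matNorm n y}) ⟨_, y₀, hy₀, rfl⟩ h
  exact ⟨y, hy, hlt⟩

theorem quotNorm_nonneg {n : ℕ} (x : Matrix (Fin n) (Fin n) (E ⧸ N)) : 0 ≤ quotNorm N x :=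
  Real.sInf_nonneg (by rintro r ⟨z, -, rfl⟩; exact apply_nonneg _ _)

theorem quotNorm_zero {n : ℕ} : quotNorm N (0 : Matrix (Fin n) (Fin n) (E ⧸ N)) = 0 := by
  refine le_antisymm ?_ (quotNorm_nonneg N _)
  have h := quotNorm_map_mkQ_le N (0 : Matrix (Fin n) (Fin n) E)
  rwa [zero_map, map_zero] at h

/-- The quotient norm as a seminorm. -/
noncomputable def quotSeminorm (n : ℕ) : Seminorm ℂ (Matrix (Fin n) (Fin n) (E ⧸ N)) :=
  Seminorm.ofSMulLE (quotNorm N) (quotNorm_zero N)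
    (fun x y => by
      refine le_of_forall_pos_lt_add fun ε hε => ?_
      obtain ⟨a, rfl, ha⟩ := exists_lt_of_quotNorm_lt N (lt_add_of_pos_right (quotNorm N x)
        (half_pos hε))
      obtain ⟨b, rfl, hb⟩ := exists_lt_of_quotNorm_lt N (lt_add_of_pos_right (quotNorm N y)
        (half_pos hε))
      rw [← add_map]
      have h1 := quotNorm_map_mkQ_le N (a + b)
      have h2 := map_add_le_add (OperatorSpace.matNorm n) a b
      linarith)
    (fun c x => by
      refine le_of_forall_pos_lt_add fun ε hε => ?_
      -- Dividing by `‖c‖ + 1` instead of `‖c‖` covers `c = 0`.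
      have hc : 0 < ‖c‖ + 1 := by positivity
      obtain ⟨a, ha, hlt⟩ := exists_lt_of_quotNorm_lt N (lt_add_of_pos_right (quotNorm N x)
        (div_pos hε hc))
      have h1 := quotNorm_map_mkQ_le N (c • a)
      rw [smul_map, ha, map_smul_eq_mul] at h1
      have h2 := mul_le_mul_of_nonneg_left hlt.le (norm_nonneg c)
      have h3 : ‖c‖ * (ε / (‖c‖ + 1)) < ε := by
        rw [← mul_div_assoc, div_lt_iff₀ hc]; nlinarith
      linarith [mul_add ‖c‖ (quotNorm N x) (ε / (‖c‖ + 1))])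

open scoped Matrix.Norms.L2Operator in
/-- The quotient of an operator space by a closed subspace. -/
noncomputable instance quotientOperatorSpace [hN : IsClosed (N : Set E)] :
    OperatorSpace (E ⧸ N) where
  toCompleteSpace := Submodule.Quotient.completeSpace N
  matNorm n := quotSeminorm N n
  matNorm_one x := by
    change quotNorm N x = _
    apply le_antisymm <;> refine le_of_forall_pos_lt_add fun ε hε => ?_
    · obtain ⟨m, hm, hlt⟩ := Submodule.Quotient.norm_mk_lt (x 0 0) hε
      have h := quotNorm_map_mkQ_le N (single m)
      rw [OperatorSpace.matNorm_one] at h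
      have hx : (single m).map N.mkQ = x := by
        rw [eq_single x, ← hm]
        rfl
      rw [hx] at h
      exact h.trans_lt hlt
    · obtain ⟨y, rfl, hy⟩ := exists_lt_of_quotNorm_lt N (lt_add_of_pos_right (quotNorm N x) hε)
      rw [OperatorSpace.matNorm_one] at hy
      exact (Submodule.Quotient.norm_mk_le N (y 0 0)).trans_lt hy
  matNorm_blocks {m n} x y := by
    change quotNorm N _ = max (quotNorm N x) (quotNorm N y)
    apply le_antisymm
    · refine le_of_forall_gt fun r hr => ?_
      rw [max_lt_iff] at hr
      obtain ⟨a, rfl, ha⟩ := exists_lt_of_quotNorm_lt N hr.1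
      obtain ⟨b, rfl, hb⟩ := exists_lt_of_quotNorm_lt N hr.2
      have h := quotNorm_map_mkQ_le N (blocks a 0 0 b)
      rw [blocks_map, zero_map, zero_map, OperatorSpace.matNorm_blocks] at h
      exact h.trans_lt (max_lt ha hb)
    · refine le_of_forall_gt fun r hr => ?_
      -- The lift `z` need not be block diagonal, but its diagonal corners lift `x` and `y` and are
      -- no larger than `z`.
      obtain ⟨z, hz, hlt⟩ := exists_lt_of_quotNorm_lt N hr
      have h1 := quotNorm_map_mkQ_le N (z.submatrix (Fin.castAdd n) (Fin.castAdd n))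
      have h2 := quotNorm_map_mkQ_le N (z.submatrix (Fin.natAdd m) (Fin.natAdd m))
      rw [← Matrix.submatrix_map, hz] at h1 h2
      have e1 : (blocks x 0 0 y).submatrix (Fin.castAdd n) (Fin.castAdd n) = x := by
        ext i j; simp [blocks]
      have e2 : (blocks x 0 0 y).submatrix (Fin.natAdd m) (Fin.natAdd m) = y := by
        ext i j; simp [blocks]
      rw [e1] at h1
      rw [e2] at h2
      exact max_lt ((h1.trans (matNorm_left_block_le z)).trans_lt hlt)
        ((h2.trans (matNorm_right_block_le z)).trans_lt hlt)
  matNorm_scalarMul {m n} α x β := by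
    change quotNorm N _ ≤ _ * quotNorm N x * _
    -- The infimum need not be attained, so the estimate is proved for every larger `r`, which then
    -- decreases to the quotient norm.
    have key : ∀ r, quotNorm N x < r → quotNorm N (scalarMul α x β) ≤ ‖α‖ * r * ‖β‖ := by
      intro r hr
      obtain ⟨a, rfl, ha⟩ := exists_lt_of_quotNorm_lt N hr
      have h := quotNorm_map_mkQ_le N (scalarMul α a β)
      rw [scalarMul_map] at h
      exact h.trans ((OperatorSpace.matNorm_scalarMul α a β).trans (by gcongr))
    refine ge_of_tendsto (x := nhdsWithin (quotNorm N x) (Set.Ioi (quotNorm N x)))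
      (f := fun r => ‖α‖ * r * ‖β‖) ?_ (Filter.eventually_of_mem self_mem_nhdsWithin key)
    exact ((continuous_const.mul continuous_id).mul continuous_const).continuousAt.mono_left
      nhdsWithin_le_nhds

variable [hN : IsClosed (N : Set E)]

theorem matNorm_mkQ_le {n : ℕ} (y : Matrix (Fin n) (Fin n) E) :
    OperatorSpace.matNorm n (y.map N.mkQ) ≤ OperatorSpace.matNorm n y :=
  quotNorm_map_mkQ_le N y

theorem exists_lt_of_matNorm_quotient_lt {n : ℕ} {x : Matrix (Fin n) (Fin n) (E ⧸ N)} {r : ℝ}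
    (h : OperatorSpace.matNorm n x < r) :
    ∃ y : Matrix (Fin n) (Fin n) E, y.map N.mkQ = x ∧ OperatorSpace.matNorm n y < r :=
  exists_lt_of_quotNorm_lt N h

/-- A lift of the zero-padded matrix need not be zero-padded; its upper right corner is still a
lift, and cutting it out does not increase the norm. -/
theorem exists_rectNorm_lt {m n : ℕ} {x : Matrix (Fin m) (Fin n) (E ⧸ N)} {r : ℝ}
    (h : rectNorm x < r) :
    ∃ y : Matrix (Fin m) (Fin n) E, y.map N.mkQ = x ∧ rectNorm y < r := by
  obtain ⟨z, hz, hlt⟩ := exists_lt_of_matNorm_quotient_lt N h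
  refine ⟨z.submatrix (Fin.castAdd n) (Fin.natAdd m), ?_,
    (rectNorm_submatrix_le z).trans_lt hlt⟩
  rw [← Matrix.submatrix_map, hz]
  ext i j
  simp [blocks]

end Quotient

section Prod

variable {E F : Type u} [NormedAddCommGroup E] [NormedSpace ℂ E] [OperatorSpace E]
variable [NormedAddCommGroup F] [NormedSpace ℂ F] [OperatorSpace F]

open scoped Matrix.Norms.L2Operator in
/-- The product of two operator spaces, with the maximum norms. -/
noncomputable instance prodOperatorSpace : OperatorSpace (E × F) where
  matNorm n := (OperatorSpace.matNorm n).comp (mapMatrix _ _ (LinearMap.fst ℂ E F)) ⊔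
    (OperatorSpace.matNorm n).comp (mapMatrix _ _ (LinearMap.snd ℂ E F))
  matNorm_one x := by
    change max (OperatorSpace.matNorm 1 (x.map (LinearMap.fst ℂ E F)))
      (OperatorSpace.matNorm 1 (x.map (LinearMap.snd ℂ E F))) = _
    rw [OperatorSpace.matNorm_one, OperatorSpace.matNorm_one]
    rfl
  matNorm_blocks x y := by
    change max (OperatorSpace.matNorm _ ((blocks x 0 0 y).map (LinearMap.fst ℂ E F)))
      (OperatorSpace.matNorm _ ((blocks x 0 0 y).map (LinearMap.snd ℂ E F))) = _
    rw [blocks_map, blocks_map, zero_map, zero_map, zero_map, zero_map,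
      OperatorSpace.matNorm_blocks, OperatorSpace.matNorm_blocks]
    exact max_max_max_comm _ _ _ _
  matNorm_scalarMul α x β := by
    change max (OperatorSpace.matNorm _ ((scalarMul α x β).map (LinearMap.fst ℂ E F)))
      (OperatorSpace.matNorm _ ((scalarMul α x β).map (LinearMap.snd ℂ E F))) ≤ _
    rw [scalarMul_map, scalarMul_map]
    change _ ≤ ‖α‖ * max (OperatorSpace.matNorm _ (x.map (LinearMap.fst ℂ E F)))
      (OperatorSpace.matNorm _ (x.map (LinearMap.snd ℂ E F))) * ‖β‖
    refine max_le ((OperatorSpace.matNorm_scalarMul _ _ _).trans ?_)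
      ((OperatorSpace.matNorm_scalarMul _ _ _).trans ?_) <;> gcongr
    · exact le_max_left _ _
    · exact le_max_right _ _

theorem matNorm_prod {n : ℕ} (x : Matrix (Fin n) (Fin n) (E × F)) :
    OperatorSpace.matNorm n x = max (OperatorSpace.matNorm n (x.map (LinearMap.fst ℂ E F)))
      (OperatorSpace.matNorm n (x.map (LinearMap.snd ℂ E F))) := rfl

theorem rectNorm_prod {m n : ℕ} (x : Matrix (Fin m) (Fin n) (E × F)) :
    rectNorm x = max (rectNorm (x.map (LinearMap.fst ℂ E F)))
      (rectNorm (x.map (LinearMap.snd ℂ E F))) := by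
  rw [rectNorm, matNorm_prod, blocks_map, blocks_map]
  simp only [zero_map, rectNorm]

/-- The zero operator space. -/
noncomputable instance punitOperatorSpace : OperatorSpace PUnit.{u + 1} where
  matNorm _ := 0
  matNorm_one _ := rfl
  matNorm_blocks _ _ := by simp
  matNorm_scalarMul _ _ _ := by simp

end Prod

/-! ### Actions of operator algebras -/

section Action

variable {H : Type v} [NormedAddCommGroup H] [InnerProductSpace ℂ H]
variable {A : NonUnitalSubalgebra ℂ (H →L[ℂ] H)}

theorem opNorm_nonneg {m n : ℕ} (a : Matrix (Fin m) (Fin n) A) : 0 ≤ opNorm a :=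
  norm_nonneg (matrixOp (a.map fun b => (b : H →L[ℂ] H)))

theorem opNorm_one_le (a : A) : opNorm (single a) ≤ ‖(a : H →L[ℂ] H)‖ := by
  refine ContinuousLinearMap.opNorm_le_bound _ (norm_nonneg _) fun x => ?_
  rw [PiLp.norm_eq_of_L2, PiLp.norm_eq_of_L2]
  simp only [Finset.univ_unique, Finset.sum_singleton, Real.sqrt_sq (norm_nonneg _)]
  simpa [matrixOp, single] using (a : H →L[ℂ] H).le_opNorm (x 0)

/-- The product `x · a` of a matrix over `E` and a matrix over `A`. -/
def actMul {E : Type u} [AddCommGroup E] [Module ℂ E] (act : E →ₗ[ℂ] A →ₗ[ℂ] E)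
    {m n p : Type*} [Fintype p] (x : Matrix m p E)
    (a : Matrix p n A) : Matrix m n E :=
  fun i j => ∑ k, act (x i k) (a k j)

theorem map_odot {E : Type u} [NormedAddCommGroup E] [NormedSpace ℂ E]
    (act : E →ₗ[ℂ] A →ₗ[ℂ] E) {n p : ℕ} (x : Matrix (Fin n) (Fin p) E)
    (a : Matrix (Fin p) (Fin n) A) :
    (odot x a).map (TensorProduct.lift act) = actMul act x a := by
  ext i j
  simp [odot, actMul]

/-- A bound by the infimum over factorizations is a bound by each factorization, which removes the
tensor product from all later verifications. -/
theorem completelyContractive_iff {E : Type u} [NormedAddCommGroup E] [NormedSpace ℂ E]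
    [OperatorSpace E] (act : E →ₗ[ℂ] A →ₗ[ℂ] E) :
    (∀ (n : ℕ) (t : Matrix (Fin n) (Fin n) (E ⊗[ℂ] A)),
      OperatorSpace.matNorm n (t.map (TensorProduct.lift act)) ≤ haagerupNorm t) ↔
    ∀ (n p : ℕ) (x : Matrix (Fin n) (Fin p) E) (a : Matrix (Fin p) (Fin n) A),
      OperatorSpace.matNorm n (actMul act x a) ≤ rectNorm x * opNorm a := by
  constructor
  · intro h n p x a
    rw [← map_odot]
    refine (h n _).trans (csInf_le ⟨0, ?_⟩ ⟨p, x, a, rfl, rfl⟩)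
    rintro r ⟨p, x, a, -, rfl⟩
    exact mul_nonneg (rectNorm_nonneg x) (opNorm_nonneg a)
  · intro h n t
    -- Some factorization has to exist, since the infimum of the empty set is `0` in `ℝ`.
    obtain ⟨p, x, a, ht⟩ := exists_eq_odot t
    refine le_csInf ⟨_, p, x, a, ht, rfl⟩ ?_
    rintro r ⟨p, x, a, rfl, rfl⟩
    rw [map_odot]
    exact h n p x a

end Action

end OpMod

/-! ### Morphisms of operator modules -/

namespace OMod

variable {H : Type v} [NormedAddCommGroup H] [InnerProductSpace ℂ H]
variable {A : NonUnitalSubalgebra ℂ (H →L[ℂ] H)}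

section Morphisms

variable {E F G : OMod.{u} A}

@[ext]
theorem hom_ext {f g : E ⟶ F} (h : ∀ x, lin f x = lin g x) : f = g :=
  Subtype.ext (LinearMap.ext h)

@[simp]
theorem lin_comp (f : E ⟶ F) (g : F ⟶ G) (x : E) : lin (f ≫ g) x = lin g (lin f x) := rfl

@[simp]
theorem lin_sub (f g : E ⟶ F) (x : E) : lin (f - g) x = lin f x - lin g x := rfl

theorem map_lin_comp (f : E ⟶ F) (g : F ⟶ G) {m n : Type*} (x : Matrix m n E) :
    x.map (lin (f ≫ g)) = (x.map (lin f)).map (lin g) := rfl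

theorem lin_act (f : E ⟶ F) (x : E) (a : A) : lin f (E.act x a) = F.act (lin f x) a :=
  f.2.1 x a

theorem mnorm_nonneg {n : ℕ} (x : Matrix (Fin n) (Fin n) E) : 0 ≤ mnorm x :=
  apply_nonneg (OperatorSpace.matNorm n) x

theorem mnorm_add_le {n : ℕ} (x y : Matrix (Fin n) (Fin n) E) :
    mnorm (x + y) ≤ mnorm x + mnorm y :=
  map_add_le_add (OperatorSpace.matNorm n) x y

theorem mnorm_smul {n : ℕ} (c : ℂ) (x : Matrix (Fin n) (Fin n) E) :
    mnorm (c • x) = ‖c‖ * mnorm x :=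
  map_smul_eq_mul (OperatorSpace.matNorm n) c x

theorem mnorm_single (x : E) : mnorm (single x) = ‖x‖ :=
  matNorm_single x

theorem exists_bound (f : E ⟶ F) : ∃ c : ℝ, 0 < c ∧
    ∀ (n : ℕ) (x : Matrix (Fin n) (Fin n) E), mnorm (x.map (lin f)) ≤ c * mnorm x := by
  obtain ⟨c, hc⟩ := f.2.2
  refine ⟨max c 1, by positivity, fun n x => (hc n x).trans ?_⟩
  exact mul_le_mul_of_nonneg_right (le_max_left c 1) (mnorm_nonneg x)

theorem continuous_lin (f : E ⟶ F) : Continuous (lin f) := by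
  obtain ⟨c, -, hc⟩ := exists_bound f
  refine ((lin f).mkContinuous c fun x => ?_).continuous
  have h := hc 1 (single x)
  rwa [mnorm_single, show (single x).map (lin f) = single (lin f x) from rfl, mnorm_single] at h

/-- The morphism given by a completely bounded module map. -/
def homMk (f : E →ₗ[ℂ] F) (h : ∀ x a, f (E.act x a) = F.act (f x) a) (c : ℝ)
    (hc : ∀ (n : ℕ) (x : Matrix (Fin n) (Fin n) E), mnorm (x.map f) ≤ c * mnorm x) : E ⟶ F :=
  ⟨f, h, c, hc⟩

end Morphisms

/-! ### Continuity of the action and approximate identities -/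

section Action

variable (E : OMod.{u} A)

theorem matNorm_actMul_le {n p : ℕ} (x : Matrix (Fin n) (Fin p) E) (a : Matrix (Fin p) (Fin n) A) :
    OperatorSpace.matNorm n (actMul E.act x a) ≤ rectNorm x * opNorm a :=
  (completelyContractive_iff E.act).1 E.act_completelyContractive n p x a

theorem norm_act_le (x : E) (a : A) : ‖E.act x a‖ ≤ ‖x‖ * ‖(a : H →L[ℂ] H)‖ := by
  have h := E.matNorm_actMul_le (single x) (single a)
  rw [eq_single (actMul _ _ _), matNorm_single] at h
  have h0 : actMul E.act (single x) (single a) 0 0 = E.act x a := by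
    simp [actMul, single]
  rw [h0] at h
  exact h.trans (mul_le_mul (rectNorm_one_le x) (opNorm_one_le a) (opNorm_nonneg _)
    (norm_nonneg x))

theorem continuous_act_right (x : E) : Continuous (E.act x) :=
  ((E.act x).mkContinuous ‖x‖ fun a => E.norm_act_le x a).continuous

theorem continuous_act_left (a : A) : Continuous (fun x => E.act x a) :=
  ((E.act.flip a).mkContinuous ‖(a : H →L[ℂ] H)‖ fun x =>
    (E.norm_act_le x a).trans_eq (mul_comm _ _)).continuous

/-- On products, `(x · a) · e = x · (a e)` tends to `x · a`. Linearity extends this to the dense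
span, and the uniform bound `‖e‖ ≤ 1` to its closure by an `ε / 3` argument. -/
theorem tendsto_act {l : Filter A} (hl : l.IsApproximateUnit)
    (hb : ∀ᶠ e : A in l, ‖(e : H →L[ℂ] H)‖ ≤ 1) (x : E) :
    Filter.Tendsto (fun e => E.act x e) l (nhds x) := by
  have hspan : ∀ y ∈ Submodule.span ℂ {z : E | ∃ x a, z = E.act x a},
      Filter.Tendsto (fun e => E.act y e) l (nhds y) := by
    intro y hy
    induction hy using Submodule.span_induction with
    | mem y hy =>
      obtain ⟨x, a, rfl⟩ := hy
      simp only [← E.act_mul]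
      exact ((E.continuous_act_right x).tendsto a).comp (hl.tendsto_mul_left a)
    | zero => simpa using tendsto_const_nhds
    | add y z _ _ hy hz => simpa using hy.add hz
    | smul c y _ hy => simpa using hy.const_smul c
  rw [Metric.tendsto_nhds]
  intro ε hε
  obtain ⟨y, hy, hxy⟩ := Metric.mem_closure_iff.1 (E.nondegenerate x) (ε / 3) (by positivity)
  filter_upwards [hb, Metric.tendsto_nhds.1 (hspan y hy) (ε / 3) (by positivity)] with e he h
  have h1 : dist (E.act x e) (E.act y e) < ε / 3 := by
    rw [dist_eq_norm, ← LinearMap.sub_apply, ← map_sub]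
    refine (E.norm_act_le _ _).trans_lt (lt_of_le_of_lt ?_ hxy)
    rw [dist_eq_norm]
    exact mul_le_of_le_one_right (norm_nonneg _) he
  calc dist (E.act x e) x ≤ dist (E.act x e) (E.act y e) + dist (E.act y e) y + dist y x :=
        dist_triangle4 _ _ _ _
    _ < ε := by rw [dist_comm y x]; linarith

end Action

/-! ### Closed submodules, quotients and products -/

section Sub

variable (hA : IsOperatorAlgebra A) (E : OMod.{u} A) (N : Submodule ℂ E)
  (hN : IsClosed (N : Set E)) (hact : ∀ x ∈ N, ∀ a, E.act x a ∈ N)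

/-- A closed submodule of an operator module. -/
noncomputable def sub : OMod.{u} A where
  carrier := N
  operatorSpace := submoduleOperatorSpace N
  act := LinearMap.mk₂ ℂ (fun x a => ⟨E.act x a, hact x x.2 a⟩)
    (fun _ _ _ => Subtype.ext (by simp)) (fun _ _ _ => Subtype.ext (by simp))
    (fun _ _ _ => Subtype.ext (by simp)) (fun _ _ _ => Subtype.ext (by simp))
  act_mul x a b := Subtype.ext (E.act_mul x a b)
  act_completelyContractive := by
    rw [completelyContractive_iff]
    intro n p x a
    rw [matNorm_submodule, rectNorm_submodule]
    refine le_of_eq_of_le (congrArg _ ?_) (E.matNorm_actMul_le (x.map N.subtype) a)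
    ext i j
    simp [actMul]
  nondegenerate x := by
    -- Non-degeneracy of `E` only approximates `x` by products from `E`; the approximate identity
    -- gives the products `x · e`, which stay in `N`.
    obtain ⟨l, hl, hb⟩ := hA.exists_approximateUnit
    have := hl.neBot
    refine mem_closure_of_tendsto (f := fun e => (⟨E.act x e, hact x x.2 e⟩ : N)) (b := l) ?_
      (Filter.Eventually.of_forall fun e => Submodule.subset_span ⟨x, e, rfl⟩)
    rw [tendsto_subtype_rng]
    exact E.tendsto_act hl hb x

/-- The inclusion of a closed submodule. -/
noncomputable def subι : sub hA E N hN hact ⟶ E :=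
  homMk (E := sub hA E N hN hact) N.subtype (fun _ _ => rfl) 1 fun _ x => (one_mul (mnorm x)).ge

theorem lin_subι_mem (x : sub hA E N hN hact) : lin (subι hA E N hN hact) x ∈ N :=
  x.2

theorem exists_lin_subι_eq {x : E} (hx : x ∈ N) : ∃ y, lin (subι hA E N hN hact) y = x :=
  ⟨⟨x, hx⟩, rfl⟩

end Sub

section Quot

variable (E : OMod.{u} A) (N : Submodule ℂ E)
  (hN : IsClosed (N : Set E)) (hact : ∀ x ∈ N, ∀ a, E.act x a ∈ N)

/-- The action on the quotient by a submodule. -/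
noncomputable def quotAct : E ⧸ N →ₗ[ℂ] A →ₗ[ℂ] E ⧸ N :=
  N.liftQ (E.act.compr₂ N.mkQ) fun x hx => by
    ext a
    simpa using hact x hx a

theorem quotAct_mk (x : E) (a : A) : quotAct E N hact (N.mkQ x) a = N.mkQ (E.act x a) := rfl

/-- The quotient of an operator module by a closed submodule. -/
noncomputable def quot : OMod.{u} A where
  carrier := E ⧸ N
  normedAddCommGroup := Submodule.Quotient.normedAddCommGroup N
  operatorSpace := quotientOperatorSpace N
  act := quotAct E N hact
  act_mul x a b := by
    obtain ⟨x, rfl⟩ := N.mkQ_surjective x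
    simp only [quotAct_mk, E.act_mul]
  act_completelyContractive := by
    rw [completelyContractive_iff]
    intro n p x a
    have key : ∀ r, rectNorm x < r →
        OperatorSpace.matNorm n (actMul (quotAct E N hact) x a) ≤ r * opNorm a := by
      intro r hr
      obtain ⟨y, rfl, hy⟩ := exists_rectNorm_lt N hr
      have h : actMul (quotAct E N hact) (y.map N.mkQ) a = (actMul E.act y a).map N.mkQ := by
        ext i j
        simp only [actMul, Matrix.map_apply, quotAct_mk, map_sum]
      rw [h]
      exact (matNorm_mkQ_le N _).trans ((E.matNorm_actMul_le y a).trans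
        (mul_le_mul_of_nonneg_right hy.le (opNorm_nonneg a)))
    refine ge_of_tendsto (x := nhdsWithin (rectNorm x) (Set.Ioi (rectNorm x)))
      (f := fun r => r * opNorm a) ?_ (Filter.eventually_of_mem self_mem_nhdsWithin key)
    exact (continuous_id.mul continuous_const).continuousAt.mono_left nhdsWithin_le_nhds
  nondegenerate := by
    have hc : Continuous N.mkQ :=
      (N.mkQ.mkContinuous 1 fun x => by
        rw [one_mul]; exact Submodule.Quotient.norm_mk_le N x).continuous
    refine (N.mkQ_surjective.denseRange.dense_image hc E.nondegenerate).mono ?_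
    rintro _ ⟨x, hx, rfl⟩
    have h := Submodule.mem_map_of_mem (f := N.mkQ) hx
    rw [Submodule.map_span] at h
    refine Submodule.span_mono ?_ h
    rintro _ ⟨_, ⟨y, a, rfl⟩, rfl⟩
    exact ⟨N.mkQ y, a, rfl⟩

/-- The quotient map. -/
noncomputable def quotπ : E ⟶ quot E N hN hact :=
  homMk (F := quot E N hN hact) N.mkQ (fun _ _ => rfl) 1
    fun _ x => (matNorm_mkQ_le N x).trans_eq (one_mul _).symm

theorem exists_lt_of_mnorm_quot_lt {n : ℕ} {x : Matrix (Fin n) (Fin n) (quot E N hN hact)} {r : ℝ}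
    (h : mnorm x < r) :
    ∃ y : Matrix (Fin n) (Fin n) E, y.map (lin (quotπ E N hN hact)) = x ∧ mnorm y < r :=
  exists_lt_of_matNorm_quotient_lt N h

theorem lin_quotπ_eq_zero_iff {x : E} : lin (quotπ E N hN hact) x = 0 ↔ x ∈ N :=
  Submodule.Quotient.mk_eq_zero N

end Quot

section Prod

theorem dense_span_prod {E F : Type*} [NormedAddCommGroup E] [NormedSpace ℂ E]
    [NormedAddCommGroup F] [NormedSpace ℂ F] {S : Set E} {T : Set F} {U : Set (E × F)}
    (hS : Dense (Submodule.span ℂ S : Set E)) (hT : Dense (Submodule.span ℂ T : Set F))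
    (h₁ : ∀ x ∈ S, (x, 0) ∈ U) (h₂ : ∀ y ∈ T, (0, y) ∈ U) :
    Dense (Submodule.span ℂ U : Set (E × F)) := by
  refine (hS.prod hT).mono ?_
  rintro ⟨x, y⟩ ⟨hx, hy⟩
  have hx' := Submodule.mem_map_of_mem (f := LinearMap.inl ℂ E F) hx
  have hy' := Submodule.mem_map_of_mem (f := LinearMap.inr ℂ E F) hy
  rw [Submodule.map_span] at hx' hy'
  have h := Submodule.add_mem _
    (Submodule.span_mono (by rintro _ ⟨z, hz, rfl⟩; exact h₁ z hz) hx')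
    (Submodule.span_mono (t := U) (by rintro _ ⟨z, hz, rfl⟩; exact h₂ z hz) hy')
  simpa using h

variable (E F : OMod.{u} A)

/-- The product of two operator modules. -/
noncomputable def prodModule : OMod.{u} A where
  carrier := E × F
  operatorSpace := prodOperatorSpace
  act := LinearMap.mk₂ ℂ (fun x a => (E.act x.1 a, F.act x.2 a))
    (fun _ _ _ => by simp) (fun _ _ _ => by simp) (fun _ _ _ => by simp) (fun _ _ _ => by simp)
  act_mul x a b := Prod.ext (E.act_mul x.1 a b) (F.act_mul x.2 a b)
  act_completelyContractive := by
    rw [completelyContractive_iff]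
    intro n p x a
    rw [matNorm_prod, rectNorm_prod]
    refine max_le ?_ ?_
    · refine le_of_eq_of_le (congrArg _ ?_) ((E.matNorm_actMul_le (x.map (LinearMap.fst ℂ E F))
        a).trans (mul_le_mul_of_nonneg_right (le_max_left _ _) (opNorm_nonneg a)))
      ext i j
      simp [actMul, Prod.fst_sum]
    · refine le_of_eq_of_le (congrArg _ ?_) ((F.matNorm_actMul_le (x.map (LinearMap.snd ℂ E F))
        a).trans (mul_le_mul_of_nonneg_right (le_max_right _ _) (opNorm_nonneg a)))
      ext i j
      simp [actMul, Prod.snd_sum]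
  nondegenerate := dense_span_prod E.nondegenerate F.nondegenerate
    (by rintro _ ⟨z, a, rfl⟩; exact ⟨(z, 0), a, by simp⟩)
    (by rintro _ ⟨z, a, rfl⟩; exact ⟨(0, z), a, by simp⟩)

/-- The first projection. -/
noncomputable def prodFst : prodModule E F ⟶ E :=
  homMk (E := prodModule E F) (LinearMap.fst ℂ E F) (fun _ _ => rfl) 1
    fun _ x => (le_max_left _ _).trans_eq (one_mul (mnorm x)).symm

/-- The second projection. -/
noncomputable def prodSnd : prodModule E F ⟶ F :=
  homMk (E := prodModule E F) (LinearMap.snd ℂ E F) (fun _ _ => rfl) 1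
    fun _ x => (le_max_right _ _).trans_eq (one_mul (mnorm x)).symm

theorem mnorm_prod {n : ℕ} (x : Matrix (Fin n) (Fin n) (prodModule E F)) :
    mnorm x = max (mnorm (x.map (lin (prodFst E F)))) (mnorm (x.map (lin (prodSnd E F)))) := rfl

theorem prod_ext {x y : prodModule E F} (h₁ : lin (prodFst E F) x = lin (prodFst E F) y)
    (h₂ : lin (prodSnd E F) x = lin (prodSnd E F) y) : x = y :=
  Prod.ext h₁ h₂

theorem exists_prod (x : E) (y : F) :
    ∃ z : prodModule E F, lin (prodFst E F) z = x ∧ lin (prodSnd E F) z = y :=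
  ⟨(x, y), rfl, rfl⟩

variable {E F}

/-- The morphism to a product with given components. -/
noncomputable def prodLift {G : OMod.{u} A} (f : G ⟶ E) (g : G ⟶ F) : G ⟶ prodModule E F :=
  homMk (F := prodModule E F) ((lin f).prod (lin g))
    (fun x a => Prod.ext (lin_act f x a) (lin_act g x a))
    (max (exists_bound f).choose (exists_bound g).choose)
    fun n x => max_le
      (((exists_bound f).choose_spec.2 n x).trans
        (mul_le_mul_of_nonneg_right (le_max_left _ _) (mnorm_nonneg x)))
      (((exists_bound g).choose_spec.2 n x).trans
        (mul_le_mul_of_nonneg_right (le_max_right _ _) (mnorm_nonneg x)))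

variable (A) in
/-- The zero module. -/
noncomputable def zeroModule : OMod.{u} A where
  carrier := PUnit
  act := 0
  act_mul _ _ _ := rfl
  act_completelyContractive := by
    rw [completelyContractive_iff]
    intro n p x a
    exact mul_nonneg (rectNorm_nonneg x) (opNorm_nonneg a)
  nondegenerate x := subset_closure (Subsingleton.elim 0 x ▸ Submodule.zero_mem _)

theorem isZero_zeroModule : IsZero (zeroModule.{u} A) :=
  (IsZero.iff_id_eq_zero _).2 (hom_ext fun _ => rfl)

instance hasBinaryProducts : HasBinaryProducts (OMod.{u} A) :=
  have (E F : OMod.{u} A) : HasLimit (pair E F) :=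
    ⟨⟨BinaryFan.mk (prodFst E F) (prodSnd E F),
      BinaryFan.isLimitMk (fun s => prodLift s.fst s.snd) (fun _ => rfl) (fun _ => rfl)
        fun _ _ h₁ h₂ => hom_ext fun x => prod_ext E F
          (congrArg (fun t => lin t x) h₁) (congrArg (fun t => lin t x) h₂)⟩⟩
  hasBinaryProducts_of_hasLimit_pair _

theorem isAdditive : ExactCat.IsAdditive (OMod.{u} A) where
  hasZeroObject := ⟨zeroModule A, isZero_zeroModule⟩
  hasBinaryProducts := hasBinaryProducts

end Prod

end OMod

/-! ### Completely bounded below and completely open morphisms -/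

namespace OMod

variable {H : Type v} [NormedAddCommGroup H] [InnerProductSpace ℂ H]
variable {A : NonUnitalSubalgebra ℂ (H →L[ℂ] H)}
variable {E F G L : OMod.{u} A}

/-- `f` is completely bounded below. -/
def IsCompletelyBoundedBelow (f : E ⟶ F) : Prop :=
  ∃ c : ℝ, 0 < c ∧ ∀ (n : ℕ) (x : Matrix (Fin n) (Fin n) E), mnorm x ≤ c * mnorm (x.map (lin f))

namespace IsCompletelyBoundedBelow

theorem of_comp {f : E ⟶ F} {g : F ⟶ G} (h : IsCompletelyBoundedBelow (f ≫ g)) :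
    IsCompletelyBoundedBelow f := by
  obtain ⟨c, hc, h⟩ := h
  obtain ⟨d, hd, hg⟩ := exists_bound g
  refine ⟨c * d, mul_pos hc hd, fun n x => (h n x).trans ?_⟩
  rw [map_lin_comp, mul_assoc]
  exact mul_le_mul_of_nonneg_left (hg n _) hc.le

theorem comp {f : E ⟶ F} {g : F ⟶ G} (hf : IsCompletelyBoundedBelow f)
    (hg : IsCompletelyBoundedBelow g) : IsCompletelyBoundedBelow (f ≫ g) := by
  obtain ⟨c, hc, hf⟩ := hf
  obtain ⟨d, hd, hg⟩ := hg
  refine ⟨c * d, mul_pos hc hd, fun n x => (hf n x).trans ?_⟩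
  rw [map_lin_comp, mul_assoc]
  exact mul_le_mul_of_nonneg_left (hg n _) hc.le

theorem id (E : OMod.{u} A) : IsCompletelyBoundedBelow (𝟙 E) :=
  ⟨1, one_pos, fun _ x => (one_mul (mnorm x)).ge⟩

theorem of_isIso (f : E ⟶ F) [IsIso f] : IsCompletelyBoundedBelow f :=
  of_comp (g := inv f) (by rw [IsIso.hom_inv_id]; exact id E)

theorem exists_norm_le {f : E ⟶ F} (hf : IsCompletelyBoundedBelow f) :
    ∃ c : ℝ, 0 < c ∧ ∀ x, ‖x‖ ≤ c * ‖lin f x‖ := by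
  obtain ⟨c, hc, h⟩ := hf
  refine ⟨c, hc, fun x => ?_⟩
  have := h 1 (single x)
  rwa [mnorm_single, show (single x).map (lin f) = single (lin f x) from rfl, mnorm_single] at this

theorem injective {f : E ⟶ F} (hf : IsCompletelyBoundedBelow f) :
    Function.Injective (lin f) := by
  obtain ⟨c, -, h⟩ := hf.exists_norm_le
  refine (injective_iff_map_eq_zero (lin f)).2 fun x hx => ?_
  have := h x
  rw [hx, norm_zero, mul_zero] at this
  exact norm_le_zero_iff.1 this

theorem isClosed_range {f : E ⟶ F} (hf : IsCompletelyBoundedBelow f) :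
    IsClosed (LinearMap.range (lin f) : Set F) := by
  obtain ⟨c, hc, h⟩ := hf.exists_norm_le
  obtain ⟨d, -, hd⟩ := exists_bound f
  have hd1 : ∀ x, ‖lin f x‖ ≤ d * ‖x‖ := fun x => by
    have := hd 1 (single x)
    rwa [mnorm_single, show (single x).map (lin f) = single (lin f x) from rfl,
      mnorm_single] at this
  have hanti : AntilipschitzWith ⟨c, hc.le⟩ ((lin f).mkContinuous d hd1) :=
    AddMonoidHomClass.antilipschitz_of_bound _ h
  rw [LinearMap.coe_range]
  exact hanti.isClosed_range ((lin f).mkContinuous d hd1).uniformContinuous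

/-- Preimages under `f` are unique, so choosing them is linear and commutes with the action; the
lower bound of `f` makes the choice completely bounded. -/
theorem exists_lift {f : E ⟶ F} (hf : IsCompletelyBoundedBelow f) (g : G ⟶ F)
    (h : ∀ x, ∃ y, lin f y = lin g x) : ∃ k : G ⟶ E, k ≫ f = g := by
  have hinj := hf.injective
  choose k hk using h
  obtain ⟨c, hc, hf⟩ := hf
  obtain ⟨d, hd, hg⟩ := exists_bound g
  let k' : G →ₗ[ℂ] E :=
    { toFun := k
      map_add' := fun x y => hinj (by simp [hk])
      map_smul' := fun a x => hinj (by simp [hk]) }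
  have hk' : ∀ x, lin f (k' x) = lin g x := hk
  refine ⟨homMk k' (fun x a => hinj ?_) (c * d) fun n x => (hf n _).trans ?_, hom_ext hk'⟩
  · rw [hk', lin_act, lin_act, hk']
  · have hx : (x.map k').map (lin f) = x.map (lin g) := by
      ext i j
      exact hk' _
    rw [hx, mul_assoc]
    exact mul_le_mul_of_nonneg_left (hg n x) hc.le

theorem mono {f : E ⟶ F} (hf : IsCompletelyBoundedBelow f) : Mono f :=
  ⟨fun _ _ hgh => hom_ext fun x => hf.injective (congrArg (fun t => lin t x) hgh)⟩

theorem nonempty_isLimit {f : E ⟶ F} (hf : IsCompletelyBoundedBelow f) {g : F ⟶ G}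
    (w : f ≫ g = 0) (h : ∀ y, lin g y = 0 → ∃ x, lin f x = y) :
    Nonempty (IsLimit (KernelFork.ofι f w)) := by
  have := hf.mono
  have hlift {M : OMod.{u} A} (k : M ⟶ F) (hk : k ≫ g = 0) : ∃ l : M ⟶ E, l ≫ f = k :=
    hf.exists_lift k fun x => h _ (congrArg (fun t => lin t x) hk)
  exact ⟨KernelFork.IsLimit.ofι' f w fun k hk => ⟨(hlift k hk).choose, (hlift k hk).choose_spec⟩⟩

theorem isCBIsoOntoClosedRange {f : E ⟶ F} (hf : IsCompletelyBoundedBelow f) :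
    IsCBIsoOntoClosedRange f := by
  refine ⟨hf.isClosed_range, ?_⟩
  have hinj := hf.injective
  let e := LinearEquiv.ofInjective (lin f) hinj
  have he : ∀ y, lin f (e.symm y) = y := fun y => congrArg Subtype.val (e.apply_symm_apply y)
  obtain ⟨c, hc, hf⟩ := hf
  refine ⟨e.symm.toLinearMap, fun x => e.symm_apply_apply x, fun y => e.apply_symm_apply y,
    fun y z a hz => hinj ?_, c, fun n y => (hf n _).trans_eq ?_⟩
  · rw [lin_act]
    exact (he z).trans (hz.trans (congrArg (fun t => F.act t a) (he y).symm))
  · congr 2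
    ext i j
    exact he _

end IsCompletelyBoundedBelow

/-- The bound on the inverse is the lower bound for `f`, and this already forces the range to be
closed by completeness of `E`. -/
theorem isCBIsoOntoClosedRange_iff {f : E ⟶ F} :
    IsCBIsoOntoClosedRange f ↔ IsCompletelyBoundedBelow f := by
  refine ⟨?_, IsCompletelyBoundedBelow.isCBIsoOntoClosedRange⟩
  rintro ⟨-, g, hg, -, -, c, hc⟩
  refine ⟨max c 1, by positivity, fun n x => ?_⟩
  have h := hc n (x.map (lin f).rangeRestrict)
  have h1 : (x.map (lin f).rangeRestrict).map g = x := by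
    ext i j
    exact hg _
  rw [h1] at h
  exact h.trans (mul_le_mul_of_nonneg_right (le_max_left c 1)
    (mnorm_nonneg (x.map (lin f))))

/-- The homogeneous form of openness: lifts exist at every scale `r`, with a constant that
multiplies under composition. -/
theorem isCompletelyOpen_iff {f : E ⟶ F} : IsCompletelyOpen f ↔
    ∃ c : ℝ, 0 < c ∧ ∀ (n : ℕ) (y : Matrix (Fin n) (Fin n) F) (r : ℝ), mnorm y < r →
      ∃ x : Matrix (Fin n) (Fin n) E, mnorm x < c * r ∧ x.map (lin f) = y := by
  constructor
  · rintro ⟨γ, hγ, h⟩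
    refine ⟨γ⁻¹, inv_pos.2 hγ, fun n y r hr => ?_⟩
    have hr0 : 0 < r := (mnorm_nonneg y).trans_lt hr
    have hs : 0 < γ / r := div_pos hγ hr0
    have hns : ‖((γ / r : ℝ) : ℂ)‖ = γ / r := by
      rw [Complex.norm_real, Real.norm_of_nonneg hs.le]
    -- Rescaling by `γ / r` brings `y` into the `γ`-ball; the lift is scaled back afterwards.
    obtain ⟨x, hx, hxy⟩ := h n (((γ / r : ℝ) : ℂ) • y) (by
      rw [mnorm_smul, hns, div_mul_eq_mul_div, div_lt_iff₀ hr0]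
      exact mul_lt_mul_of_pos_left hr hγ)
    refine ⟨((γ / r : ℝ) : ℂ)⁻¹ • x, ?_, ?_⟩
    · rw [mnorm_smul, norm_inv, hns, inv_div, ← div_eq_inv_mul]
      calc r / γ * mnorm x < r / γ * 1 := mul_lt_mul_of_pos_left hx (div_pos hr0 hγ)
        _ = r / γ := mul_one _
    · rw [smul_map, hxy, smul_smul, inv_mul_cancel₀ (Complex.ofReal_ne_zero.2 hs.ne'), one_smul]
  · rintro ⟨c, hc, h⟩
    refine ⟨c⁻¹, inv_pos.2 hc, fun n y hy => ?_⟩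
    obtain ⟨x, hx, hxy⟩ := h n y c⁻¹ hy
    exact ⟨x, by rwa [mul_inv_cancel₀ hc.ne'] at hx, hxy⟩

namespace IsCompletelyOpen

theorem of_comp {f : E ⟶ F} {g : F ⟶ G} (h : IsCompletelyOpen (f ≫ g)) : IsCompletelyOpen g := by
  rw [isCompletelyOpen_iff] at h ⊢
  obtain ⟨c, hc, h⟩ := h
  obtain ⟨d, hd, hf⟩ := exists_bound f
  refine ⟨d * c, mul_pos hd hc, fun n y r hr => ?_⟩
  obtain ⟨x, hx, hxy⟩ := h n y r hr
  refine ⟨x.map (lin f), (hf n x).trans_lt ?_, hxy⟩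
  rw [mul_assoc]
  exact mul_lt_mul_of_pos_left hx hd

theorem comp {f : E ⟶ F} {g : F ⟶ G} (hf : IsCompletelyOpen f) (hg : IsCompletelyOpen g) :
    IsCompletelyOpen (f ≫ g) := by
  rw [isCompletelyOpen_iff] at hf hg ⊢
  obtain ⟨c, hc, hf⟩ := hf
  obtain ⟨d, hd, hg⟩ := hg
  refine ⟨c * d, mul_pos hc hd, fun n z r hr => ?_⟩
  obtain ⟨y, hy, rfl⟩ := hg n z r hr
  obtain ⟨x, hx, rfl⟩ := hf n y _ hy
  exact ⟨x, by rwa [mul_assoc], rfl⟩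

theorem id (E : OMod.{u} A) : IsCompletelyOpen (𝟙 E) :=
  ⟨1, one_pos, fun _ y hy => ⟨y, hy, rfl⟩⟩

theorem of_isIso (f : E ⟶ F) [IsIso f] : IsCompletelyOpen f :=
  of_comp (f := inv f) (by rw [IsIso.inv_hom_id]; exact id F)

theorem surjective {f : E ⟶ F} (hf : IsCompletelyOpen f) : Function.Surjective (lin f) := by
  rw [isCompletelyOpen_iff] at hf
  obtain ⟨c, -, h⟩ := hf
  intro y
  obtain ⟨x, -, hx⟩ := h 1 (single y) _ (lt_add_one _)
  exact ⟨x 0 0, congrFun (congrFun hx 0) 0⟩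

theorem epi {f : E ⟶ F} (hf : IsCompletelyOpen f) : Epi f :=
  ⟨fun g h hgh => hom_ext fun y => by
    obtain ⟨x, rfl⟩ := hf.surjective y
    exact congrArg (fun t => lin t x) hgh⟩

theorem exists_desc {f : E ⟶ F} (hf : IsCompletelyOpen f) (g : E ⟶ G)
    (h : ∀ x, lin f x = 0 → lin g x = 0) : ∃ k : F ⟶ G, f ≫ k = g := by
  have hs := hf.surjective
  rw [isCompletelyOpen_iff] at hf
  obtain ⟨c, hc, hf⟩ := hf
  obtain ⟨d, hd, hg⟩ := exists_bound g
  choose s hs using hs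
  -- Two preimages differ by an element killed by `f`, hence by `g`, so the chosen section `s` need
  -- not be linear.
  have hsg : ∀ x y, lin f x = y → lin g (s y) = lin g x := fun x y hxy => by
    rw [← sub_eq_zero, ← map_sub]
    exact h _ (by rw [map_sub, hs, hxy, sub_self])
  let k : F →ₗ[ℂ] G :=
    { toFun := fun y => lin g (s y)
      map_add' := fun x y => by rw [← map_add]; exact hsg _ _ (by simp [hs])
      map_smul' := fun a x => by rw [RingHom.id_apply, ← map_smul]; exact hsg _ _ (by simp [hs]) }
  have hk : ∀ x, k (lin f x) = lin g x := fun x => hsg _ _ rfl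
  refine ⟨homMk k (fun y a => ?_) (d * c) fun n y => ?_, hom_ext hk⟩
  · rw [← hs y, ← lin_act, hk, hk, lin_act]
  · refine le_of_forall_gt_imp_ge_of_dense fun t ht => ?_
    have hdc := mul_pos hd hc
    obtain ⟨x, hx, rfl⟩ := hf n y (t / (d * c)) (by rwa [lt_div_iff₀' hdc])
    have hkx : (x.map (lin f)).map k = x.map (lin g) := by
      ext i j
      exact hk _
    rw [hkx]
    refine (hg n x).trans ((mul_le_mul_of_nonneg_left hx.le hd.le).trans_eq ?_)
    rw [← mul_assoc, mul_div_cancel₀ _ hdc.ne']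

/-- Density of the range in the null space suffices, since a continuous map that vanishes on the
range vanishes on its closure. -/
theorem nonempty_isColimit {g : F ⟶ G} (hg : IsCompletelyOpen g) {f : E ⟶ F}
    (w : f ≫ g = 0) (h : ∀ y, lin g y = 0 → y ∈ closure (Set.range (lin f))) :
    Nonempty (IsColimit (CokernelCofork.ofπ g w)) := by
  have := hg.epi
  have hdesc {M : OMod.{u} A} (k : F ⟶ M) (hk : f ≫ k = 0) : ∃ l : G ⟶ M, g ≫ l = k := by
    refine hg.exists_desc k fun y hy => ?_
    refine closure_minimal (s := Set.range (lin f)) (t := {y | lin k y = 0}) ?_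
      (isClosed_eq (continuous_lin k) continuous_const) (h y hy)
    rintro _ ⟨x, rfl⟩
    exact congrArg (fun t => lin t x) hk
  exact ⟨CokernelCofork.IsColimit.ofπ' g w fun k hk =>
    ⟨(hdesc k hk).choose, (hdesc k hk).choose_spec⟩⟩

end IsCompletelyOpen

/-! ### Kernels and cokernels -/

theorem isCompletelyBoundedBelow_subι (hA : IsOperatorAlgebra A)
    (E : OMod.{u} A) (N : Submodule ℂ E)
    (hN : IsClosed (N : Set E)) (hact : ∀ x ∈ N, ∀ a, E.act x a ∈ N) :
    IsCompletelyBoundedBelow (subι hA E N hN hact) :=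
  ⟨1, one_pos, fun _ x => (one_mul (mnorm x)).ge⟩

theorem isCompletelyOpen_quotπ (E : OMod.{u} A) (N : Submodule ℂ E)
    (hN : IsClosed (N : Set E)) (hact : ∀ x ∈ N, ∀ a, E.act x a ∈ N) :
    IsCompletelyOpen (quotπ E N hN hact) :=
  ⟨1, one_pos, fun _ _ hy => (exists_lt_of_mnorm_quot_lt E N hN hact hy).imp fun _ h => h.symm⟩

/-- The kernel of a morphism, as a closed submodule. -/
noncomputable def ker (hA : IsOperatorAlgebra A) (f : E ⟶ F) : OMod.{u} A :=
  sub hA E (LinearMap.ker (lin f)) (isClosed_eq (continuous_lin f) continuous_const)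
    fun x hx a => by
      rw [LinearMap.mem_ker] at hx ⊢
      rw [lin_act, hx, map_zero, LinearMap.zero_apply]

/-- The inclusion of the kernel. -/
noncomputable def kerι (hA : IsOperatorAlgebra A) (f : E ⟶ F) : ker hA f ⟶ E := subι _ _ _ _ _

theorem mnorm_map_kerι (hA : IsOperatorAlgebra A)
    (f : E ⟶ F) {n : ℕ} (x : Matrix (Fin n) (Fin n) (ker hA f)) :
    mnorm (x.map (lin (kerι hA f))) = mnorm x := rfl

theorem isCompletelyBoundedBelow_kerι (hA : IsOperatorAlgebra A)
    (f : E ⟶ F) : IsCompletelyBoundedBelow (kerι hA f) :=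
  isCompletelyBoundedBelow_subι _ _ _ _ _

theorem kerι_comp (hA : IsOperatorAlgebra A) (f : E ⟶ F) : kerι hA f ≫ f = 0 :=
  hom_ext fun x => lin_subι_mem hA E _ _ _ x

theorem exists_lin_kerι_eq (hA : IsOperatorAlgebra A) (f : E ⟶ F) {x : E} (hx : lin f x = 0) :
    ∃ y, lin (kerι hA f) y = x :=
  exists_lin_subι_eq hA E _ _ _ hx

theorem nonempty_isLimit_kerι (hA : IsOperatorAlgebra A) (f : E ⟶ F) :
    Nonempty (IsLimit (KernelFork.ofι (kerι hA f) (kerι_comp hA f))) :=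
  (isCompletelyBoundedBelow_kerι hA f).nonempty_isLimit _ fun _ => exists_lin_kerι_eq hA f

/-- The cokernel of a morphism, as the quotient by the closure of its range. -/
noncomputable def coker (f : E ⟶ F) : OMod.{u} A :=
  quot F (LinearMap.range (lin f)).topologicalClosure
    (Submodule.isClosed_topologicalClosure _) fun x hx a => by
      refine map_mem_closure (f := fun x => F.act x a) (F.continuous_act_left a) hx ?_
      rintro _ ⟨y, rfl⟩
      exact ⟨E.act y a, lin_act f y a⟩

/-- The projection to the cokernel. -/
noncomputable def cokerπ (f : E ⟶ F) : F ⟶ coker f := quotπ _ _ _ _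

theorem isCompletelyOpen_cokerπ (f : E ⟶ F) : IsCompletelyOpen (cokerπ f) :=
  isCompletelyOpen_quotπ _ _ _ _

theorem exists_lt_of_mnorm_coker_lt (f : E ⟶ F) {n : ℕ} {x : Matrix (Fin n) (Fin n) (coker f)}
    {r : ℝ} (h : mnorm x < r) :
    ∃ y : Matrix (Fin n) (Fin n) F, y.map (lin (cokerπ f)) = x ∧ mnorm y < r :=
  exists_lt_of_mnorm_quot_lt _ _ _ _ h

theorem lin_cokerπ_eq_zero_iff (f : E ⟶ F) {y : F} :
    lin (cokerπ f) y = 0 ↔ y ∈ closure (Set.range (lin f)) :=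
  lin_quotπ_eq_zero_iff F _ _ _

theorem comp_cokerπ (f : E ⟶ F) : f ≫ cokerπ f = 0 :=
  hom_ext fun x => (lin_cokerπ_eq_zero_iff f).2 (subset_closure ⟨x, rfl⟩)

theorem nonempty_isColimit_cokerπ (f : E ⟶ F) :
    Nonempty (IsColimit (CokernelCofork.ofπ (cokerπ f) (comp_cokerπ f))) :=
  (isCompletelyOpen_cokerπ f).nonempty_isColimit _ fun _ => (lin_cokerπ_eq_zero_iff f).1

theorem IsCompletelyBoundedBelow.exists_of_lin_cokerπ_eq_zero {f : E ⟶ F}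
    (hf : IsCompletelyBoundedBelow f) {y : F} (hy : lin (cokerπ f) y = 0) :
    ∃ x, lin f x = y := by
  have h := (lin_cokerπ_eq_zero_iff f).1 hy
  rw [← LinearMap.coe_range, hf.isClosed_range.closure_eq] at h
  exact h

/-- Comparison with the model gives `f = k ≫ kerι` with `k` a split monomorphism, hence completely
bounded below by cancellation. -/
theorem isCompletelyBoundedBelow_of_isLimit (hA : IsOperatorAlgebra A)
    {f : E ⟶ F} {g : F ⟶ G} {w : f ≫ g = 0}
    (h : IsLimit (KernelFork.ofι f w)) : IsCompletelyBoundedBelow f := by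
  obtain ⟨l, hl⟩ := KernelFork.IsLimit.lift' h (kerι hA g) (kerι_comp hA g)
  obtain ⟨k, hk⟩ := KernelFork.IsLimit.lift' (nonempty_isLimit_kerι hA g).some f w
  change l ≫ f = kerι hA g at hl
  change k ≫ kerι hA g = f at hk
  have hkl : k ≫ l = 𝟙 E := by
    refine Fork.IsLimit.hom_ext h ?_
    change (k ≫ l) ≫ f = 𝟙 E ≫ f
    rw [Category.assoc, hl, hk, Category.id_comp]
  have hk' : IsCompletelyBoundedBelow k :=
    .of_comp (g := l) (by rw [hkl]; exact .id E)
  rw [← hk]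
  exact hk'.comp (isCompletelyBoundedBelow_kerι hA g)

theorem exists_of_isLimit (hA : IsOperatorAlgebra A) {f : E ⟶ F} {g : F ⟶ G} {w : f ≫ g = 0}
    (h : IsLimit (KernelFork.ofι f w)) {y : F} (hy : lin g y = 0) : ∃ x, lin f x = y := by
  obtain ⟨l, hl⟩ := KernelFork.IsLimit.lift' h (kerι hA g) (kerι_comp hA g)
  obtain ⟨z, rfl⟩ := exists_lin_kerι_eq hA g hy
  exact ⟨lin l z, congrArg (fun t => lin t z) hl⟩

/-- Dually, `g` is the model cokernel followed by a split epimorphism. -/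
theorem isCompletelyOpen_of_isColimit {f : E ⟶ F} {g : F ⟶ G} {w : f ≫ g = 0}
    (h : IsColimit (CokernelCofork.ofπ g w)) : IsCompletelyOpen g := by
  obtain ⟨d, hd⟩ := CokernelCofork.IsColimit.desc' h (cokerπ f) (comp_cokerπ f)
  obtain ⟨e, he⟩ := CokernelCofork.IsColimit.desc' (nonempty_isColimit_cokerπ f).some g w
  change g ≫ d = cokerπ f at hd
  change cokerπ f ≫ e = g at he
  have hde : d ≫ e = 𝟙 G := by
    refine Cofork.IsColimit.hom_ext h ?_
    change g ≫ d ≫ e = g ≫ 𝟙 G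
    rw [← Category.assoc, hd, he, Category.comp_id]
  have he' : IsCompletelyOpen e := .of_comp (f := d) (by rw [hde]; exact .id G)
  rw [← he]
  exact (isCompletelyOpen_cokerπ f).comp he'

/-! ### Kernel–cokernel pairs and admissible morphisms -/

open ExactCat

theorem kernelCokernelPair_iff (hA : IsOperatorAlgebra A) (S : ShortComplex (OMod.{u} A)) :
    KernelCokernelPair S ↔ IsCompletelyBoundedBelow S.f ∧ IsCompletelyOpen S.g ∧
      ∀ y, lin S.g y = 0 → ∃ x, lin S.f x = y := by
  constructor
  · rintro ⟨⟨h₁⟩, ⟨h₂⟩⟩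
    exact ⟨isCompletelyBoundedBelow_of_isLimit hA h₁, isCompletelyOpen_of_isColimit h₂,
      fun _ => exists_of_isLimit hA h₁⟩
  · rintro ⟨hf, hg, h⟩
    exact ⟨hf.nonempty_isLimit _ h, hg.nonempty_isColimit _ fun y hy => subset_closure (h y hy)⟩

/-- The range of a morphism that is completely bounded below is closed, so the morphism is the
kernel of its own cokernel. -/
theorem isKernelMap_iff (hA : IsOperatorAlgebra A)
    (f : E ⟶ F) : IsKernelMap f ↔ IsCompletelyBoundedBelow f := by
  constructor
  · rintro ⟨Z, g, w, ⟨h⟩⟩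
    exact isCompletelyBoundedBelow_of_isLimit hA h
  · intro hf
    exact ⟨_, _, comp_cokerπ f,
      hf.nonempty_isLimit _ fun _ => hf.exists_of_lin_cokerπ_eq_zero⟩

theorem admissibleMono_iff (hA : IsOperatorAlgebra A) (f : E ⟶ F) :
    AdmissibleMono KernelCokernelPair f ↔ IsCompletelyBoundedBelow f := by
  constructor
  · rintro ⟨Z, g, w, h⟩
    exact ((kernelCokernelPair_iff hA _).1 h).1
  · intro hf
    exact ⟨_, _, comp_cokerπ f, (kernelCokernelPair_iff hA _).2
      ⟨hf, isCompletelyOpen_cokerπ f, fun _ => hf.exists_of_lin_cokerπ_eq_zero⟩⟩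

theorem isCokernelMap_iff (hA : IsOperatorAlgebra A)
    (f : E ⟶ F) : IsCokernelMap f ↔ IsCompletelyOpen f := by
  constructor
  · rintro ⟨Z, g, w, ⟨h⟩⟩
    exact isCompletelyOpen_of_isColimit h
  · intro hf
    exact ⟨_, _, kerι_comp hA f, hf.nonempty_isColimit _ fun _ hy =>
      subset_closure (exists_lin_kerι_eq hA f hy)⟩

theorem admissibleEpi_iff (hA : IsOperatorAlgebra A) (f : E ⟶ F) :
    AdmissibleEpi KernelCokernelPair f ↔ IsCompletelyOpen f := by
  constructor
  · rintro ⟨Z, g, w, h⟩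
    exact ((kernelCokernelPair_iff hA _).1 h).2.1
  · intro hf
    exact ⟨_, _, kerι_comp hA f, (kernelCokernelPair_iff hA _).2
      ⟨isCompletelyBoundedBelow_kerι hA f, hf, fun _ => exists_lin_kerι_eq hA f⟩⟩

theorem kernelCokernelPair_of_iso (hA : IsOperatorAlgebra A)
    {S T : ShortComplex (OMod.{u} A)} (e : S ≅ T)
    (h : KernelCokernelPair S) : KernelCokernelPair T := by
  rw [kernelCokernelPair_iff hA] at h ⊢
  obtain ⟨hf, hg, hex⟩ := h
  have ef : T.f = e.inv.τ₁ ≫ S.f ≫ e.hom.τ₂ := by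
    rw [← e.hom.comm₁₂, ← Category.assoc, ← ShortComplex.comp_τ₁, e.inv_hom_id,
      ShortComplex.id_τ₁, Category.id_comp]
  have eg : T.g = e.inv.τ₂ ≫ S.g ≫ e.hom.τ₃ := by
    rw [← e.hom.comm₂₃, ← Category.assoc, ← ShortComplex.comp_τ₂, e.inv_hom_id,
      ShortComplex.id_τ₂, Category.id_comp]
  refine ⟨?_, ?_, fun y hy => ?_⟩
  · rw [ef]
    exact (IsCompletelyBoundedBelow.of_isIso _).comp (hf.comp (.of_isIso _))
  · rw [eg]
    exact (IsCompletelyOpen.of_isIso _).comp (hg.comp (.of_isIso _))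
  · obtain ⟨x, hx⟩ := hex (lin e.inv.τ₂ y) (by
      rw [← lin_comp, e.inv.comm₂₃, lin_comp, hy, map_zero])
    refine ⟨lin e.hom.τ₁ x, ?_⟩
    rw [← lin_comp, e.hom.comm₁₂, lin_comp, hx, ← lin_comp, ← ShortComplex.comp_τ₂, e.inv_hom_id]
    rfl

theorem hasKernels (hA : IsOperatorAlgebra A) : HasKernels (OMod.{u} A) :=
  ⟨fun f => ⟨⟨_, (nonempty_isLimit_kerι hA f).some⟩⟩⟩

theorem hasCokernels : HasCokernels (OMod.{u} A) :=
  ⟨fun f => ⟨⟨_, (nonempty_isColimit_cokerπ f).some⟩⟩⟩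

/-! ### Pullbacks and pushouts -/

theorem hasPullbacks (hA : IsOperatorAlgebra A) : HasPullbacks (OMod.{u} A) := by
  have := hasKernels.{u} hA
  have : HasEqualizers (OMod.{u} A) := Preadditive.hasEqualizers_of_hasKernels
  exact hasPullbacks_of_hasBinaryProducts_of_hasEqualizers _

theorem hasPushouts : HasPushouts (OMod.{u} A) := by
  have := hasCokernels.{u} (A := A)
  have : HasCoequalizers (OMod.{u} A) := Preadditive.hasCoequalizers_of_hasCokernels
  have : HasBinaryBiproducts (OMod.{u} A) := HasBinaryBiproducts.of_hasBinaryProducts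
  exact hasPushouts_of_hasBinaryCoproducts_of_hasCoequalizers _

/-- Given `y`, openness of `f` yields a controlled `x` with `f x = g y`; the pair `(x, y)` lies in
the model pullback and is carried to `L` over `F`. -/
theorem isCompletelyOpen_of_isPullback (hA : IsOperatorAlgebra A)
    {p : L ⟶ E} {q : L ⟶ F} {f : E ⟶ G} {g : F ⟶ G}
    (h : IsPullback p q f g) (hf : IsCompletelyOpen f) : IsCompletelyOpen q := by
  rw [isCompletelyOpen_iff] at hf ⊢
  obtain ⟨c, hc, hf⟩ := hf
  obtain ⟨d, hd, hg⟩ := exists_bound g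
  let D : prodModule E F ⟶ G := prodFst E F ≫ f - prodSnd E F ≫ g
  have hD : (kerι hA D ≫ prodFst E F) ≫ f = (kerι hA D ≫ prodSnd E F) ≫ g := by
    have := kerι_comp hA D
    rwa [Preadditive.comp_sub, sub_eq_zero, ← Category.assoc, ← Category.assoc] at this
  obtain ⟨l, -, hl⟩ := h.exists_lift _ _ hD
  obtain ⟨e, he, hle⟩ := exists_bound l
  -- The pair has the maximum norm: `c * d` controls `x` and `1` controls `y`.
  have hm : 0 < max (c * d) 1 := by positivity
  refine ⟨e * max (c * d) 1, mul_pos he hm, fun n y r hr => ?_⟩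
  obtain ⟨x, hx, hxy⟩ := hf n (y.map (lin g)) (d * r)
    ((hg n y).trans_lt (mul_lt_mul_of_pos_left hr hd))
  have hr0 : 0 < r := (mnorm_nonneg y).trans_lt hr
  choose z hz₁ hz₂ using fun i j => exists_prod E F (x i j) (y i j)
  choose t ht using fun i j => exists_lin_kerι_eq hA D (x := z i j) (by
    have := congrFun (congrFun hxy i) j
    simp only [Matrix.map_apply] at this
    simp only [D, lin_sub, lin_comp, hz₁, hz₂, this, sub_self])
  let z' : Matrix (Fin n) (Fin n) (prodModule E F) := z
  let t' : Matrix (Fin n) (Fin n) (ker hA D) := t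
  have htz : t'.map (lin (kerι hA D)) = z' := by
    ext i j : 2
    exact ht i j
  have ht' : mnorm t' < max (c * d) 1 * r := by
    rw [← mnorm_map_kerι, htz, mnorm_prod]
    have e₁ : z'.map (lin (prodFst E F)) = x := by
      ext i j
      exact hz₁ i j
    have e₂ : z'.map (lin (prodSnd E F)) = y := by
      ext i j
      exact hz₂ i j
    rw [e₁, e₂]
    refine max_lt (hx.trans_le ?_) (hr.trans_le ?_)
    · rw [← mul_assoc]
      exact mul_le_mul_of_nonneg_right (le_max_left _ _) hr0.le
    · exact le_mul_of_one_le_left hr0.le (le_max_right _ _)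
  refine ⟨t'.map (lin l), (hle n t').trans_lt ?_, ?_⟩
  · rw [mul_assoc]
    exact mul_lt_mul_of_pos_left ht' he
  · rw [← map_lin_comp, hl, map_lin_comp, htz]
    ext i j
    exact hz₂ i j

/-- By cancellation it suffices to bound `F` below in the model pushout, the cokernel of `(f, -g)`.
-/
theorem isCompletelyBoundedBelow_of_isPushout {f : G ⟶ E} {g : G ⟶ F} {p : E ⟶ L} {q : F ⟶ L}
    (h : IsPushout f g p q) (hf : IsCompletelyBoundedBelow f) : IsCompletelyBoundedBelow q := by
  let D : G ⟶ prodModule E F := prodLift f (-g)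
  have hDf : IsCompletelyBoundedBelow D := .of_comp (g := prodFst E F) hf
  let inl : E ⟶ prodModule E F := prodLift (𝟙 E) 0
  let inr : F ⟶ prodModule E F := prodLift 0 (𝟙 F)
  have hsub : f ≫ inl - g ≫ inr = D := hom_ext fun x => prod_ext E F
    (sub_zero (lin f x)) (zero_sub (lin g x))
  have hD : f ≫ inl ≫ cokerπ D = g ≫ inr ≫ cokerπ D := by
    rw [← sub_eq_zero, ← Category.assoc, ← Category.assoc, ← Preadditive.sub_comp, hsub,
      comp_cokerπ]
  obtain ⟨l, -, hl⟩ := h.exists_desc _ _ hD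
  refine .of_comp (g := l) ?_
  rw [hl]
  obtain ⟨c, hc, hf⟩ := hf
  obtain ⟨d, hd, hg⟩ := exists_bound g
  have hdc : 0 < 1 + d * c := by positivity
  refine ⟨1 + d * c, hdc, fun n y => le_of_forall_gt_imp_ge_of_dense fun t ht => ?_⟩
  obtain ⟨z, hz, hzt⟩ := exists_lt_of_mnorm_coker_lt D
    (x := y.map (lin (inr ≫ cokerπ D))) (r := t / (1 + d * c)) (by rwa [lt_div_iff₀' hdc])
  -- Both `z` and `(0, y)` represent the same class and `D` has closed range, so `z - (0, y) = (f w,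
  -- -g w)`. Thus `f w` is the first component of `z`, and `y` is its second component plus `g w`.
  choose w hw using fun i j => hDf.exists_of_lin_cokerπ_eq_zero
    (y := z i j - lin inr (y i j)) (by
      rw [map_sub, sub_eq_zero]
      exact congrFun (congrFun hz i) j)
  let w' : Matrix (Fin n) (Fin n) G := w
  have e₁ : w'.map (lin f) = z.map (lin (prodFst E F)) := by
    ext i j
    have := congrArg (lin (prodFst E F)) (hw i j)
    rw [map_sub] at this
    exact this.trans (sub_zero _)
  have e₂ : y = z.map (lin (prodSnd E F)) + w'.map (lin g) := by
    ext i j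
    have := congrArg (lin (prodSnd E F)) (hw i j)
    rw [map_sub] at this
    change -lin g (w i j) = lin (prodSnd E F) (z i j) - y i j at this
    change y i j = lin (prodSnd E F) (z i j) + lin g (w i j)
    rw [← neg_neg (lin g (w i j)), this]
    abel
  have h₁ := le_max_left (mnorm (z.map (lin (prodFst E F)))) (mnorm (z.map (lin (prodSnd E F))))
  have h₂ := le_max_right (mnorm (z.map (lin (prodFst E F)))) (mnorm (z.map (lin (prodSnd E F))))
  rw [← mnorm_prod] at h₁ h₂
  have h₃ := hf n w'
  rw [e₁] at h₃
  -- The lower bound of `f` controls `w` by the first component of `z`; this is the source of `d *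
  -- c`.
  have h₄ : mnorm (w'.map (lin g)) ≤ d * (c * mnorm z) := (hg n w').trans
    (mul_le_mul_of_nonneg_left (h₃.trans (mul_le_mul_of_nonneg_left h₁ hc.le)) hd.le)
  calc mnorm y ≤ mnorm z + d * (c * mnorm z) := by
        rw [e₂]
        exact (mnorm_add_le _ _).trans (add_le_add h₂ h₄)
    _ = (1 + d * c) * mnorm z := by ring
    _ ≤ (1 + d * c) * (t / (1 + d * c)) := mul_le_mul_of_nonneg_left hzt.le hdc.le
    _ = t := mul_div_cancel₀ _ hdc.ne'

/-! ### The exact structure and quasi-abelianness -/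

theorem axiomE2 (hA : IsOperatorAlgebra A)
    : AxiomE2 (KernelCokernelPair (C := OMod.{u} A)) := fun f g hf => by
  have := hasPushouts.{u} (A := A)
  rw [admissibleMono_iff hA] at hf
  exact ⟨inferInstance, fun h k hP =>
    (admissibleMono_iff hA k).2 (isCompletelyBoundedBelow_of_isPushout hP hf)⟩

theorem axiomE2op (hA : IsOperatorAlgebra A)
    : AxiomE2op (KernelCokernelPair (C := OMod.{u} A)) := fun f g hf => by
  have := hasPullbacks.{u} hA
  rw [admissibleEpi_iff hA] at hf
  exact ⟨inferInstance, fun h k hP =>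
    (admissibleEpi_iff hA k).2 (isCompletelyOpen_of_isPullback hA hP hf)⟩

theorem isExactStructure (hA : IsOperatorAlgebra A) :
    IsExactStructure (KernelCokernelPair : ShortComplex (OMod.{u} A) → Prop) where
  kernelCokernelPair _ h := h
  of_iso _ _ := fun ⟨e⟩ => kernelCokernelPair_of_iso hA e
  e0 X := (admissibleMono_iff hA _).2 (.id X)
  e0op X := (admissibleEpi_iff hA _).2 (.id X)
  e1 f g hf hg := (admissibleMono_iff hA _).2
    (((admissibleMono_iff hA f).1 hf).comp ((admissibleMono_iff hA g).1 hg))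
  e1op f g hf hg := (admissibleEpi_iff hA _).2
    (((admissibleEpi_iff hA f).1 hf).comp ((admissibleEpi_iff hA g).1 hg))
  e2 := axiomE2 hA
  e2op := axiomE2op hA

theorem isQuasiAbelian (hA : IsOperatorAlgebra A) : IsQuasiAbelian (OMod.{u} A) where
  isAdditive := isAdditive
  hasKernels := hasKernels hA
  hasCokernels := hasCokernels
  e2 := axiomE2 hA
  e2op := axiomE2op hA

end OMod

open ExactCat OMod in
theorem mainTheorem3 {H : Type v} [NormedAddCommGroup H] [InnerProductSpace ℂ H] [CompleteSpace H]
    (A : NonUnitalSubalgebra ℂ (H →L[ℂ] H)) (hA : IsOperatorAlgebra A) :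
    -- `OMod A` is additive and the class of all kernel-cokernel pairs is an exact structure on it
    (IsAdditive (OMod.{u} A) ∧
      IsExactStructure (KernelCokernelPair : ShortComplex (OMod.{u} A) → Prop)) ∧
    -- `OMod A` is quasi-abelian
    IsQuasiAbelian (OMod.{u} A) ∧
    -- description of kernels and cokernels
    (∀ {E F : OMod.{u} A} (f : E ⟶ F), IsKernelMap f ↔ IsCBIsoOntoClosedRange f) ∧
    (∀ {E F : OMod.{u} A} (f : E ⟶ F), IsCokernelMap f ↔ IsCompletelyOpen f) ∧
    -- pullbacks exist and preserve cokernels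
    (HasPullbacks (OMod.{u} A) ∧
      ∀ {E F G L : OMod.{u} A} (p : L ⟶ E) (q : L ⟶ F) (f : E ⟶ G) (g : F ⟶ G),
        IsPullback p q f g → IsCokernelMap f → IsCokernelMap q) ∧
    -- pushouts exist and preserve kernels
    (HasPushouts (OMod.{u} A) ∧
      ∀ {E F G L : OMod.{u} A} (f : G ⟶ E) (g : G ⟶ F) (p : E ⟶ L) (q : F ⟶ L),
        IsPushout f g p q → IsKernelMap f → IsKernelMap q) :=
  ⟨⟨isAdditive, isExactStructure hA⟩, isQuasiAbelian hA,
    fun f => (isKernelMap_iff hA f).trans isCBIsoOntoClosedRange_iff.symm,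
    fun f => isCokernelMap_iff hA f,
    ⟨hasPullbacks hA, fun _ q f _ h hf => (isCokernelMap_iff hA q).2
      (isCompletelyOpen_of_isPullback hA h ((isCokernelMap_iff hA f).1 hf))⟩,
    ⟨hasPushouts, fun f _ _ q h hf => (isKernelMap_iff hA q).2
      (isCompletelyBoundedBelow_of_isPushout h ((isKernelMap_iff hA f).1 hf))⟩⟩
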